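/- Consider a finite class of multi-armed bandits with bounded rewards. That is, let $\mathcal A$ (actions) and $\mathcal O$ (parameters) be finite non-empty sets, let $\mathcal S=\{s\}$ have one state, let $\mathcal Y$ be any measurable space of outcomes, $T\in\mathbb N$ a horizon, and $r:\mathcal Y\times\mathcal A\to[0,1]$ a measurable reward function. Under the parameter $\theta\in\mathcal O$, when action $A_t$ is played in round $t$, an outcome $Y_t$ is drawn, independently of the past, from a distribution $y(\cdot\mid A_t,\theta)$ on $\mathcal Y$ (which may or may not depend on $A_t$), the agent observes $Y_t$ and receives the reward $r(Y_t,A_t)$. A deterministic policy $\pi\in\mathcal P$ chooses $A_t$ as a measurable function of the history $(A_1,Y_1,\dots,A_{t-1},Y_{t-1})$; a randomized one draws $A_t$ from a distribution depending measurably on the history. Put $U(\pi,\theta)=\mathbb E^\theta_\pi\big[\sum_{t=1}^T r(Y_t,A_t)\big]$, let $U^*(\theta)$ be the supremum of the utilities of the policies that play one fixed action in all rounds, let $\mathfrak R(\pi,\theta)=U^*(\theta)-U(\pi,\theta)$ be the regret, and define $$\mathfrak M=\inf_{\mathbb P_\Pi\in\Delta(\mathcal P)}\ \sup_{\theta\in\mathcal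 O}\ \mathbb E_\Pi[\mathfrak R(\Pi,\theta)],\qquad \mathfrak{BR}(\pi,\mathbb P_\Theta)=\mathbb E_{\Theta\sim\mathbb P_\Theta}[\mathfrak R(\pi,\Theta)],$$ $$\mathfrak F(\mathbb P_\Theta)=\inf_{\pi\in\mathcal P}\mathfrak{BR}(\pi,\mathbb P_\Theta),\qquad \mathfrak F^*=\sup_{\mathbb P_\Theta\in\Delta(\mathcal O)}\mathfrak F(\mathbb P_\Theta),$$ where $\Delta(\mathcal P)$ is the set of probability measures on $\mathcal P$ as a discrete space and $\Delta(\mathcal O)$ the set of priors on $\mathcal O$. For a prior $\mathbb P_\Theta$ let $f^\star:\mathcal O\to\mathcal A$ maximize $\mathbb E\big[\sum_{t=1}^T r(Y_t,f(\Theta))\big]$ (the utility of playing $f(\Theta)$ in every round) over all $f:\mathcal O\to\mathcal A$, let $A^\star=f^\star(\Theta)$ be the optimal action, and let $H(A^\star)$ be its Shannon entropy in nats. Thompson sampling for $(\mathbb P_\Theta,f^\star)$ is a randomized policy whose conditional law of $A_t$ given the history is, in each round $t\le T$, the posterior law of $A^\star$ given the history. Then: 1. (minimax duality) $\mathfrak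 M=\mathfrak F^*$; 2. (Bayesian bound) for every prior $\mathbb P_\Theta$ a maximizer $f^\star$ exists, and for every maximizer $f^\star$ Thompson sampling exists, every version $\hat\pi$ of it satisfies $\mathfrak{BR}(\hat\pi,\mathbb P_\Theta)\le\sqrt{\tfrac12|\mathcal A|\,H(A^\star)\,T}$, and $\mathfrak F(\mathbb P_\Theta)\le\sqrt{\tfrac12|\mathcal A|\,H(A^\star)\,T}$; 3. (minimax bound) $\mathfrak M\le\sqrt{\tfrac12|\mathcal A|\log|\mathcal A|\,T}$; in particular $\mathfrak M=O\big(\sqrt{|\mathcal A|\log|\mathcal A|\,T}\big)$ with a universal constant. -/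

import Mathlib

open MeasureTheory ProbabilityTheory

noncomputable section

/-- A class of finite-horizon Markov decision processes with state space `S`, action space `A` and
outcome space `Y`, parameterized by `θ : O`. In each round, given the state `s`, the action `a` and
the parameter `θ`, the outcome and the next state are drawn (conditionally independently) from
`outcome (s, a, θ)` and `trans (s, a, θ)`, and the reward is `reward (y, a)`.
The outcome kernel is allowed to depend on the action: a kernel that ignores the action is a special
case, and so is the bandit in which only the reward of the pulled arm is observed. -/
structure MDPClass (S A O Y : Type*) [MeasurableSpace S] [MeasurableSpace A] [MeasurableSpace O]
    [MeasurableSpace Y] where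
  start : Kernel O S
  trans : Kernel (S × A × O) S
  outcome : Kernel (S × A × O) Y
  reward : Y × A → ℝ
  horizon : ℕ
  markov_start : IsMarkovKernel start
  markov_trans : IsMarkovKernel trans
  markov_outcome : IsMarkovKernel outcome
  measurable_reward : Measurable reward

/-- Histories after `t` completed rounds: the triples (state, action, outcome) of these rounds. -/
abbrev Hist (S A Y : Type*) (t : ℕ) : Type _ := Fin t → S × A × Y

/-- A deterministic policy: in the round that follows `t` completed rounds it chooses an action from
the history and the current state. Only the rounds before the horizon matter. -/
structure Policy (S A Y : Type*) [MeasurableSpace S] [MeasurableSpace A] [MeasurableSpace Y] where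
  act : ∀ t : ℕ, Hist S A Y t × S → A
  measurable_act : ∀ t, Measurable (act t)

/-- The space of deterministic policies is a discrete space: every set is measurable. -/
instance (S A Y : Type*) [MeasurableSpace S] [MeasurableSpace A] [MeasurableSpace Y] :
    MeasurableSpace (Policy S A Y) := ⊤

/-- A policy that draws its action in each round from a distribution that depends on the history and
the current state (such as Thompson sampling). -/
structure RandPolicy (S A Y : Type*) [MeasurableSpace S] [MeasurableSpace A]
    [MeasurableSpace Y] where
  kernel : ∀ t : ℕ, Kernel (Hist S A Y t × S) A
  markov : ∀ t, IsMarkovKernel (kernel t)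

attribute [instance] MDPClass.markov_start MDPClass.markov_trans MDPClass.markov_outcome
  RandPolicy.markov

/-- A deterministic policy as a randomized one. -/
def Policy.toRand {S A Y : Type*} [MeasurableSpace S] [MeasurableSpace A] [MeasurableSpace Y]
    (π : Policy S A Y) : RandPolicy S A Y where
  kernel t := Kernel.deterministic (π.act t) (π.measurable_act t)
  markov _ := inferInstance

/-- The deterministic policy that plays `f s` in state `s`, in every round. -/
def Policy.ofState {S A Y : Type*} [MeasurableSpace S] [MeasurableSpace A] [MeasurableSpace Y]
    (f : S → A) (hf : Measurable f) : Policy S A Y where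
  act _ x := f x.2
  measurable_act _ := hf.comp measurable_snd

/-- Shannon entropy (natural logarithm) of a distribution on a finite set. -/
def shannonEntropy {A : Type*} [Fintype A] [MeasurableSpace A] (μ : Measure A) : ℝ :=
  ∑ a, Real.negMulLog (μ.real {a})

/-- Appending a finished round to the history, and moving on to the next state. -/
def nextHist {S A Y : Type*} (t : ℕ) (x : ((Hist S A Y t × S) × A) × (Y × S)) :
    Hist S A Y (t + 1) × S :=
  (Fin.snoc (α := fun _ => S × A × Y) x.1.1.1 (x.1.1.2, x.1.2, x.2.1), x.2.2)

theorem measurable_nextHist {S A Y : Type*} [MeasurableSpace S] [MeasurableSpace A]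
    [MeasurableSpace Y] (t : ℕ) : Measurable (nextHist (S := S) (A := A) (Y := Y) t) := by
  refine Measurable.prodMk (measurable_pi_iff.2 fun i => ?_) (by fun_prop)
  refine Fin.lastCases ?_ (fun j => ?_) i
  · simp only [Fin.snoc_last]; fun_prop
  · simp only [Fin.snoc_castSucc]; fun_prop

namespace MDPClass

variable {S A O Y : Type*} [MeasurableSpace S] [MeasurableSpace A] [MeasurableSpace O]
  [MeasurableSpace Y] (M : MDPClass S A O Y)

/-- The joint law, under the parameter `θ` and the policy `π`, of the history of the first `t` rounds
and of the state that follows them. -/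
def law (π : RandPolicy S A Y) : (t : ℕ) → Kernel O (Hist S A Y t × S)
  | 0 => M.start.map (fun s => (Fin.elim0, s))
  | t + 1 =>
    ((law π t ⊗ₖ Kernel.prodMkLeft O (π.kernel t)) ⊗ₖ
      (M.outcome ×ₖ M.trans).comap
        (fun x : O × ((Hist S A Y t × S) × A) => (x.2.1.2, x.2.2, x.1))
        (by fun_prop)).map (nextHist t)

theorem isMarkovKernel_law (π : RandPolicy S A Y) (t : ℕ) : IsMarkovKernel (M.law π t) := by
  induction t with
  | zero => exact Kernel.IsMarkovKernel.map _ (by fun_prop)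
  | succ t ih => exact Kernel.IsMarkovKernel.map _ (measurable_nextHist t)

/-- The expected cumulative reward of the policy `π` under the parameter `θ`. -/
def utility (π : RandPolicy S A Y) (θ : O) : ℝ :=
  ∫ x, ∑ i : Fin M.horizon, M.reward ((x.1 i).2.2, (x.1 i).2.1) ∂(M.law π M.horizon θ)

/-- The optimal utility under `θ`: the supremum over the maps from states to actions. -/
def optUtility (θ : O) : ℝ :=
  ⨆ f : {f : S → A // Measurable f}, M.utility (Policy.ofState f.1 f.2).toRand θ

def regret (π : RandPolicy S A Y) (θ : O) : ℝ := M.optUtility θ - M.utility π θ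

/-- The minimax regret, with the infimum over the distributions on the deterministic policies. -/
def minimaxRegret : ℝ :=
  ⨅ Q : ProbabilityMeasure (Policy S A Y),
    ⨆ θ : O, ∫ π, M.regret π.toRand θ ∂(Q : Measure (Policy S A Y))

def bayesRegret (π : RandPolicy S A Y) (P : ProbabilityMeasure O) : ℝ :=
  ∫ θ, M.regret π θ ∂(P : Measure O)

/-- The minimum Bayesian regret under the prior `P`. -/
def minBayesRegret (P : ProbabilityMeasure O) : ℝ :=
  ⨅ π : Policy S A Y, M.bayesRegret π.toRand P

/-- The worst-case minimum Bayesian regret. -/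
def worstMinBayesRegret : ℝ := ⨆ P : ProbabilityMeasure O, M.minBayesRegret P

/-- The expected cumulative reward under the prior `P` of an agent who knows the parameter `θ` and
plays `f (s, θ)` in state `s`. -/
def informedUtility (P : ProbabilityMeasure O) (f : S × O → A) (hf : Measurable f) : ℝ :=
  ∫ θ, M.utility (Policy.ofState (fun s => f (s, θ)) (hf.comp measurable_prodMk_right)).toRand θ
    ∂(P : Measure O)

/-- `f` maximizes the expected cumulative reward among the maps that know the parameter. -/
def IsOptimalMap (P : ProbabilityMeasure O) (f : S × O → A) : Prop :=
  ∃ hf : Measurable f, ∀ (g : S × O → A) (hg : Measurable g),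
    M.informedUtility P g hg ≤ M.informedUtility P f hf

/-- `π` is Thompson sampling for the prior `P` and the optimal map `f`: in each round, the
conditional law of the action it plays, given the history and the current state `s`, is the
posterior law of the optimal action `f (s, Θ)`. -/
def IsThompsonSampling (P : ProbabilityMeasure O) (f : S × O → A) (π : RandPolicy S A Y) : Prop :=
  ∀ t < M.horizon,
    (M.law π t ∘ₘ (P : Measure O)) ⊗ₘ π.kernel t =
      ((P : Measure O) ⊗ₘ M.law π t).map (fun x => (x.2, f (x.2.2, x.1)))

end MDPClass

end

/-! The Bayesian bound rests on exponential supermartingales in place of mutual information. Each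
action `b` gets a potential `Φ b`, which grows only in rounds where `b` is played, by `w * (r - m) -
w ^ 2 / 8`. Here `r` is the reward, `m` the posterior mean reward of `b`, `w = l / q`, and `q` the
conditional probability of playing `b`. Under the Bayesian mixture of the laws, `r` has conditional
mean `m`, so Hoeffding's lemma keeps the expectation of `exp (Φ b)` at most `1`
(`integral_exp_succ_le`).

Evaluate the potential at the optimal action `A⋆`. From above, an entropy duality bounds its
expectation by `H(A⋆)` (`integral_potential_le_entropy`). From below, up to a cutoff error, each
round contributes `l` times its regret minus `l ^ 2 * |A| / 8` (`le_integral_increment`): under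
Thompson sampling the played action and `A⋆` have the same conditional law, so `m` at `A⋆` averages
to the reward of the round, and `1 / q` at `A⋆` averages to at most `∑ a, q a / q a ≤ |A|`.
Optimizing over `l` gives the square root with the factor `1 / 2`.

Some deterministic policy does at least as well on average over the prior as a given randomized one
(`exists_policy_integral_utility_le`), which carries the bound over to the infimum over
deterministic policies. Duality is a minimax theorem for bounded payoffs with a finite parameter
set, by separating convex sets in `O → ℝ` (`iInf_iSup_integral_eq_iSup_iInf_integral`). The minimax
bound then follows from `H(A⋆) ≤ log |A|`. -/

/-! ### Bounded measurable functions, integrable for every finite measure. -/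

/-- Bounded measurable real functions. -/
def BddMeas {X : Type*} [MeasurableSpace X] (g : X → ℝ) : Prop :=
  Measurable g ∧ ∃ C, ∀ x, |g x| ≤ C

namespace BddMeas

variable {X Z : Type*} [MeasurableSpace X] [MeasurableSpace Z] {f g : X → ℝ}

theorem integrable (hg : BddMeas g) (μ : Measure X) [IsFiniteMeasure μ] : Integrable g μ := by
  obtain ⟨hm, C, hC⟩ := hg
  exact Integrable.of_bound hm.aestronglyMeasurable C (Filter.Eventually.of_forall hC)

theorem const (c : ℝ) : BddMeas fun _ : X => c := ⟨measurable_const, |c|, fun _ => le_rfl⟩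

theorem add (hf : BddMeas f) (hg : BddMeas g) : BddMeas fun x => f x + g x := by
  obtain ⟨hf, C, hC⟩ := hf
  obtain ⟨hg, D, hD⟩ := hg
  exact ⟨hf.add hg, C + D, fun x => (abs_add_le _ _).trans (add_le_add (hC x) (hD x))⟩

theorem mul (hf : BddMeas f) (hg : BddMeas g) : BddMeas fun x => f x * g x := by
  obtain ⟨hf, C, hC⟩ := hf
  obtain ⟨hg, D, hD⟩ := hg
  refine ⟨hf.mul hg, C * D, fun x => ?_⟩
  rw [abs_mul]
  exact mul_le_mul (hC x) (hD x) (abs_nonneg _) ((abs_nonneg _).trans (hC x))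

theorem neg (hf : BddMeas f) : BddMeas fun x => -f x := by
  simpa using (const (-1)).mul hf

theorem sub (hf : BddMeas f) (hg : BddMeas g) : BddMeas fun x => f x - g x := by
  simpa [sub_eq_add_neg] using hf.add hg.neg

theorem exp (hf : BddMeas f) : BddMeas fun x => Real.exp (f x) := by
  obtain ⟨hf, C, hC⟩ := hf
  refine ⟨hf.exp, Real.exp C, fun x => ?_⟩
  rw [abs_of_pos (Real.exp_pos _)]
  exact Real.exp_le_exp.2 ((le_abs_self _).trans (hC x))

theorem sum {ι : Type*} (s : Finset ι) {f : ι → X → ℝ} (h : ∀ i ∈ s, BddMeas (f i)) :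
    BddMeas fun x => ∑ i ∈ s, f i x := by
  classical
  induction s using Finset.induction_on with
  | empty => simpa using const 0
  | insert i s hi ih =>
    simp only [Finset.sum_insert hi]
    exact (h i (by simp)).add (ih fun j hj => h j (by simp [hj]))

theorem comp (hg : BddMeas g) {u : Z → X} (hu : Measurable u) : BddMeas fun z => g (u z) := by
  obtain ⟨hg, C, hC⟩ := hg
  exact ⟨hg.comp hu, C, fun z => hC _⟩

theorem of_mem_Icc {a b : ℝ} (hg : Measurable g) (h : ∀ x, g x ∈ Set.Icc a b) : BddMeas g :=
  ⟨hg, max |a| |b|, fun x => abs_le_max_abs_abs (h x).1 (h x).2⟩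

/-- A function on a finite discrete product factor is bounded measurable if its sections are. -/
theorem of_finite [Finite Z] [MeasurableSingletonClass Z] {g : Z × X → ℝ}
    (h : ∀ z, BddMeas fun x => g (z, x)) : BddMeas g := by
  refine ⟨measurable_from_prod_countable_right fun z => (h z).1, ?_⟩
  choose C hC using fun z => (h z).2
  obtain ⟨D, hD⟩ := (Set.finite_range C).bddAbove
  exact ⟨D, fun x => (hC x.1 x.2).trans (hD ⟨_, rfl⟩)⟩

theorem of_finite_fun [Finite Z] [MeasurableSingletonClass Z] {g : Z → ℝ} : BddMeas g := by
  refine ⟨measurable_of_countable g, ?_⟩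
  obtain ⟨D, hD⟩ := (Set.finite_range fun z => |g z|).bddAbove
  exact ⟨D, fun x => hD ⟨_, rfl⟩⟩

theorem abs_integral_le {C : ℝ} (hC : ∀ x, |g x| ≤ C) (μ : Measure X) [IsProbabilityMeasure μ] :
    |∫ x, g x ∂μ| ≤ C := by
  simpa using norm_integral_le_of_norm_le_const (μ := μ) (f := g) (Filter.Eventually.of_forall hC)

theorem integral_kernel {g : X × Z → ℝ} (hg : BddMeas g) (κ : Kernel X Z) [IsMarkovKernel κ] :
    BddMeas fun x => ∫ z, g (x, z) ∂κ x := by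
  obtain ⟨hg, C, hC⟩ := hg
  exact ⟨(hg.stronglyMeasurable.integral_kernel_prod_right' (κ := κ)).measurable, C,
    fun x => abs_integral_le (fun z => hC _) _⟩

theorem integral_right {g : X × Z → ℝ} (hg : BddMeas g) (μ : Measure Z) [IsProbabilityMeasure μ] :
    BddMeas fun x => ∫ z, g (x, z) ∂μ :=
  hg.integral_kernel (Kernel.const X μ)

theorem integral_kernel_of_finite [Finite Z] [MeasurableSingletonClass Z] {g : Z → X → ℝ}
    (hg : ∀ z, BddMeas (g z)) (κ : Kernel X Z) [IsMarkovKernel κ] :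
    BddMeas fun x => ∫ z, g z x ∂κ x := by
  have h : BddMeas fun p : Z × X => g p.1 p.2 := of_finite hg
  have h' : BddMeas fun p : X × Z => g p.2 p.1 := h.comp measurable_swap
  exact h'.integral_kernel κ

theorem kernel_real (κ : Kernel X Z) [IsMarkovKernel κ] {s : Set Z} (hs : MeasurableSet s) :
    BddMeas fun x => (κ x).real s :=
  of_mem_Icc (a := 0) (b := 1) (κ.measurable_coe hs).ennreal_toReal
    fun _ => ⟨measureReal_nonneg, measureReal_le_one⟩

end BddMeas

theorem sum_measureReal_singleton_eq_one {A : Type*} [Fintype A] [MeasurableSpace A]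
    [MeasurableSingletonClass A] (μ : Measure A) [IsProbabilityMeasure μ] :
    ∑ a, μ.real {a} = 1 := by
  simp

theorem integral_const_add_of_isProbabilityMeasure {X : Type*} [MeasurableSpace X]
    (μ : Measure X) [IsProbabilityMeasure μ] {g : X → ℝ} (hg : BddMeas g) (c : ℝ) :
    ∫ x, (c + g x) ∂μ = c + ∫ x, g x ∂μ := by
  rw [integral_add (integrable_const _) (hg.integrable μ)]
  simp

/-! ### One-round recursion for expectations. -/

namespace MDPClass

attribute [instance] isMarkovKernel_law

variable {S A O Y : Type*} [MeasurableSpace S] [MeasurableSpace A] [MeasurableSpace O]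
  [MeasurableSpace Y] [Unique S] [Fintype A] [MeasurableSingletonClass A]

/-- The next state carries no information because `S` is a point, so one round reduces to a sum over
actions and an integral over outcomes. -/
theorem integral_law_succ (M : MDPClass S A O Y) (π : RandPolicy S A Y) (t : ℕ) (θ : O)
    {g : Hist S A Y (t + 1) × S → ℝ} (hg : BddMeas g) :
    ∫ x, g x ∂M.law π (t + 1) θ =
      ∫ x, ∑ a, (π.kernel t x).real {a} *
        ∫ y, g (nextHist t ((x, a), (y, default))) ∂M.outcome (default, a, θ) ∂M.law π t θ := by
  have h1 : BddMeas fun x => g (nextHist t x) := hg.comp (measurable_nextHist t)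
  rw [law, Kernel.map_apply _ (measurable_nextHist t),
    integral_map (measurable_nextHist t).aemeasurable hg.1.aestronglyMeasurable,
    integral_compProd (h1.integrable _)]
  set κ := (M.outcome ×ₖ M.trans).comap
        (fun x : O × ((Hist S A Y t × S) × A) => (x.2.1.2, x.2.2, x.1)) (by fun_prop)
  have h2 : BddMeas fun x => ∫ y, g (nextHist t (x, y)) ∂(κ (θ, x)) := by
    exact h1.integral_kernel (κ.comap (fun x => (θ, x)) (by fun_prop))
  rw [integral_compProd (h2.integrable _)]
  refine integral_congr_ae (Filter.Eventually.of_forall fun x => ?_)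
  simp only
  rw [Kernel.prodMkLeft_apply, integral_fintype (Integrable.of_finite)]
  refine Finset.sum_congr rfl fun a _ => ?_
  rw [smul_eq_mul]
  congr 1
  have h3 : BddMeas fun z => g (nextHist t ((x, a), z)) := h1.comp (by fun_prop)
  rw [show κ (θ, (x, a)) = (M.outcome (default, a, θ)).prod (M.trans (default, a, θ)) by
    rw [Kernel.comap_apply, Kernel.prod_apply, Subsingleton.elim x.2 default],
    integral_prod _ (h3.integrable _)]
  refine integral_congr_ae (Filter.Eventually.of_forall fun y => ?_)
  simp [integral_unique]

end MDPClass

/-! ### Bayes' rule over a finite parameter set. -/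

section Bayes

variable {O X A : Type*} [MeasurableSpace O] [MeasurableSpace X] [MeasurableSpace A]
  [Finite O] [MeasurableSingletonClass O]
  (P : Measure O) [IsProbabilityMeasure P] (κ : Kernel O X) [IsMarkovKernel κ]

theorem integral_compProd_of_finite {g : O → X → ℝ} (hg : ∀ θ, BddMeas (g θ)) :
    ∫ θ, ∫ x, g θ x ∂κ θ ∂P = ∫ z, g z.1 z.2 ∂(P ⊗ₘ κ) := by
  have h : BddMeas fun z : O × X => g z.1 z.2 := BddMeas.of_finite hg
  rw [Measure.integral_compProd (h.integrable _)]

/-- The joint law of parameter and observation is disintegrated in both orders; finiteness of `O`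
supplies joint measurability. -/
theorem integral_integral_eq_posterior [Nonempty O] {g : O → X → ℝ} (hg : ∀ θ, BddMeas (g θ)) :
    ∫ θ, ∫ x, g θ x ∂κ θ ∂P = ∫ x, ∫ θ, g θ x ∂(posterior κ P x) ∂(κ ∘ₘ P) := by
  have h : BddMeas fun z : O × X => g z.1 z.2 := BddMeas.of_finite hg
  have h' : BddMeas fun z : X × O => g z.2 z.1 := h.comp measurable_swap
  rw [integral_compProd_of_finite P κ hg, ← Measure.integral_compProd (h'.integrable _),
    compProd_posterior_eq_map_swap,
    integral_map measurable_swap.aemeasurable h'.1.aestronglyMeasurable]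
  rfl

theorem integral_integral_eq_comp [Nonempty O] {g : X → ℝ} (hg : BddMeas g) :
    ∫ θ, ∫ x, g x ∂κ θ ∂P = ∫ x, g x ∂(κ ∘ₘ P) := by
  rw [integral_integral_eq_posterior P κ (g := fun _ => g) fun _ => hg]
  simp

variable [Fintype A] [MeasurableSingletonClass A]

/-- The form in which the Thompson property is used: `f θ` may be exchanged for the played action in
integrands that see `θ` only through `f θ`. -/
theorem integral_integral_eq_sum_kernel {f : O → A} {η : Kernel X A} [IsMarkovKernel η]
    (h : (κ ∘ₘ P) ⊗ₘ η = (P ⊗ₘ κ).map fun z => (z.2, f z.1))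
    {g : A → X → ℝ} (hg : ∀ a, BddMeas (g a)) :
    ∫ θ, ∫ x, g (f θ) x ∂κ θ ∂P = ∫ x, ∑ a, (η x).real {a} * g a x ∂(κ ∘ₘ P) := by
  have h1 : BddMeas fun z : X × A => g z.2 z.1 :=
    (BddMeas.of_finite (g := fun z : A × X => g z.1 z.2) hg).comp measurable_swap
  have hf : Measurable f := measurable_of_countable f
  have e := Measure.integral_compProd (h1.integrable ((κ ∘ₘ P) ⊗ₘ η))
  rw [h, integral_map (by fun_prop) h1.1.aestronglyMeasurable] at e
  rw [integral_compProd_of_finite P κ (g := fun θ => g (f θ)) fun θ => hg (f θ), e]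
  refine integral_congr_ae (Filter.Eventually.of_forall fun x => ?_)
  simp only
  rw [integral_fintype Integrable.of_finite]
  rfl

end Bayes

/-! ### Hoeffding's lemma, and rewards round by round. -/

/-- **Hoeffding's lemma** for a mixture. -/
theorem integral_exp_centered_le_one {O Y : Type*} [MeasurableSpace O] [MeasurableSpace Y]
    [Finite O] [MeasurableSingletonClass O] (p : Measure O) [IsProbabilityMeasure p]
    (κ : Kernel O Y) [IsMarkovKernel κ] {r : Y → ℝ} (hr : Measurable r)
    (h : ∀ y, r y ∈ Set.Icc (0 : ℝ) 1) (s : ℝ) :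
    ∫ θ, ∫ y, Real.exp (s * (r y - ∫ θ, ∫ y, r y ∂κ θ ∂p) - s ^ 2 / 8) ∂κ θ ∂p ≤ 1 := by
  have hb : BddMeas r := BddMeas.of_mem_Icc hr h
  rw [integral_compProd_of_finite p κ (g := fun _ => r) fun _ => hb,
    integral_compProd_of_finite p κ (g := fun _ y => Real.exp (s * (r y - ∫ z, r z.2 ∂(p ⊗ₘ κ)) -
      s ^ 2 / 8)) fun _ => (((BddMeas.const s).mul (hb.sub (BddMeas.const _))).sub
      (BddMeas.const _)).exp]
  have H := (hasSubgaussianMGF_of_mem_Icc (μ := p ⊗ₘ κ) (X := fun z => r z.2) (a := 0) (b := 1)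
    (by fun_prop) (Filter.Eventually.of_forall fun z => h z.2)).mgf_le s
  simp only [mgf] at H
  simp_rw [Real.exp_sub]
  rw [integral_div, div_le_one (Real.exp_pos _)]
  -- An interval of length `1` has variance proxy `1 / 4`, whence the exponent `s ^ 2 / 8`.
  refine H.trans (Real.exp_le_exp.2 (le_of_eq ?_))
  simp
  ring

namespace MDPClass

variable {S A O Y : Type*} [MeasurableSpace S] [MeasurableSpace A] [MeasurableSpace O]
  [MeasurableSpace Y] [Unique S] [Fintype A] [MeasurableSingletonClass A]
  (M : MDPClass S A O Y)

/-- The expected reward of one round in which `a` is played. -/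
noncomputable def meanReward (a : A) (θ : O) : ℝ :=
  ∫ y, M.reward (y, a) ∂M.outcome (default, a, θ)

/-- The expected reward of the round after `t` completed rounds. -/
noncomputable def roundReward (π : RandPolicy S A Y) (t : ℕ) (θ : O) : ℝ :=
  ∫ x, ∑ a, (π.kernel t x).real {a} * M.meanReward a θ ∂M.law π t θ

variable {M}

omit [Unique S] [Fintype A] [MeasurableSingletonClass A] in
theorem bddMeas_reward (hr : ∀ z, M.reward z ∈ Set.Icc (0 : ℝ) 1) : BddMeas M.reward :=
  BddMeas.of_mem_Icc M.measurable_reward hr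

omit [Fintype A] [MeasurableSingletonClass A] in
theorem meanReward_mem_Icc (hr : ∀ z, M.reward z ∈ Set.Icc (0 : ℝ) 1) (a : A) (θ : O) :
    M.meanReward a θ ∈ Set.Icc (0 : ℝ) 1 := by
  refine ⟨integral_nonneg fun y => (hr _).1, ?_⟩
  have h := integral_mono (μ := M.outcome (default, a, θ))
    (((bddMeas_reward hr).comp (u := fun y => (y, a)) (by fun_prop)).integrable _)
    (integrable_const 1) fun y => (hr (y, a)).2
  simpa [meanReward] using h

omit [Fintype A] [MeasurableSingletonClass A] in
theorem integral_exp_reward_le_one [Finite O] [MeasurableSingletonClass O]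
    (hr : ∀ z, M.reward z ∈ Set.Icc (0 : ℝ) 1) (p : Measure O) [IsProbabilityMeasure p]
    (a : A) (s : ℝ) :
    ∫ θ, ∫ y, Real.exp (s * (M.reward (y, a) - ∫ θ, M.meanReward a θ ∂p) - s ^ 2 / 8)
      ∂M.outcome (default, a, θ) ∂p ≤ 1 :=
  integral_exp_centered_le_one p (M.outcome.comap (fun θ : O => ((default : S), a, θ)) (by fun_prop))
    (r := fun y => M.reward (y, a)) (M.measurable_reward.comp (by fun_prop)) (fun _ => hr _) s

theorem roundReward_mem_Icc (hr : ∀ z, M.reward z ∈ Set.Icc (0 : ℝ) 1) (π : RandPolicy S A Y)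
    (t : ℕ) (θ : O) : M.roundReward π t θ ∈ Set.Icc (0 : ℝ) 1 := by
  refine ⟨integral_nonneg fun x => Finset.sum_nonneg fun a _ =>
    mul_nonneg measureReal_nonneg (meanReward_mem_Icc hr a θ).1, ?_⟩
  have h := integral_mono (μ := M.law π t θ)
    (BddMeas.integrable (g := fun x => ∑ a, (π.kernel t x).real {a} * M.meanReward a θ)
      (BddMeas.sum _ fun a _ => (BddMeas.kernel_real _ (measurableSet_singleton a)).mul
        (BddMeas.const _)) _) (integrable_const 1) fun x => by
      rw [← sum_measureReal_singleton_eq_one (π.kernel t x)]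
      exact Finset.sum_le_sum fun a _ =>
        mul_le_of_le_one_right measureReal_nonneg (meanReward_mem_Icc hr a θ).2
  simpa [roundReward] using h

theorem integral_sum_reward (hr : ∀ z, M.reward z ∈ Set.Icc (0 : ℝ) 1) (π : RandPolicy S A Y)
    (t : ℕ) (θ : O) :
    ∫ x, ∑ i : Fin t, M.reward ((x.1 i).2.2, (x.1 i).2.1) ∂M.law π t θ =
      ∑ i ∈ Finset.range t, M.roundReward π i θ := by
  have hb := bddMeas_reward hr
  have hs (t : ℕ) : BddMeas fun x : Hist S A Y t × S =>
      ∑ i : Fin t, M.reward ((x.1 i).2.2, (x.1 i).2.1) :=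
    BddMeas.sum _ fun i _ => hb.comp (by fun_prop)
  induction t with
  | zero => simp
  | succ t ih =>
    rw [integral_law_succ _ _ _ _ (hs (t + 1)), Finset.sum_range_succ, ← ih, roundReward,
      ← integral_add ((hs t).integrable _)
        ((BddMeas.sum _ fun a _ => (BddMeas.kernel_real _ (measurableSet_singleton a)).mul
          (BddMeas.const _)).integrable _)]
    refine integral_congr_ae (Filter.Eventually.of_forall fun x => ?_)
    simp only [Fin.sum_univ_castSucc, nextHist, Fin.snoc_castSucc, Fin.snoc_last]
    conv_rhs =>
      arg 1
      rw [← one_mul (Finset.sum _ _), ← sum_measureReal_singleton_eq_one (π.kernel t x),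
        Finset.sum_mul]
    rw [← Finset.sum_add_distrib]
    refine Finset.sum_congr rfl fun a _ => ?_
    rw [integral_const_add_of_isProbabilityMeasure _ (hb.comp (by fun_prop)), mul_add]
    rfl

theorem utility_eq_sum (hr : ∀ z, M.reward z ∈ Set.Icc (0 : ℝ) 1) (π : RandPolicy S A Y) (θ : O) :
    M.utility π θ = ∑ i ∈ Finset.range M.horizon, M.roundReward π i θ :=
  integral_sum_reward hr π M.horizon θ

theorem utility_ofState (hr : ∀ z, M.reward z ∈ Set.Icc (0 : ℝ) 1) {f : S → A} (hf : Measurable f)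
    (θ : O) :
    M.utility (Policy.ofState f hf).toRand θ = M.horizon * M.meanReward (f default) θ := by
  have h (i : ℕ) : M.roundReward (Policy.ofState f hf).toRand i θ =
      M.meanReward (f default) θ := by
    have e (x : Hist S A Y i × S) : ∑ a, (((Policy.ofState f hf).toRand : RandPolicy S A Y).kernel
        i x).real {a} * M.meanReward a θ = M.meanReward (f default) θ := by
      rw [Finset.sum_eq_single (f default)]
      · simp [Policy.toRand, Policy.ofState, Kernel.deterministic_apply, measureReal_def,
          Subsingleton.elim x.2 default]
      · intro a _ ha
        simp [Policy.toRand, Policy.ofState, Kernel.deterministic_apply, measureReal_def,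
          Subsingleton.elim x.2 default, ha.symm]
      · simp
    simp [roundReward, e]
  simp [utility_eq_sum hr, h]

theorem utility_mem_Icc (hr : ∀ z, M.reward z ∈ Set.Icc (0 : ℝ) 1) (π : RandPolicy S A Y) (θ : O) :
    M.utility π θ ∈ Set.Icc (0 : ℝ) M.horizon := by
  rw [utility_eq_sum hr]
  refine ⟨Finset.sum_nonneg fun i _ => (roundReward_mem_Icc hr π i θ).1, ?_⟩
  simpa using Finset.sum_le_sum fun i (_ : i ∈ Finset.range M.horizon) =>
    (roundReward_mem_Icc hr π i θ).2

theorem le_optUtility (hr : ∀ z, M.reward z ∈ Set.Icc (0 : ℝ) 1) (a : A) (θ : O) :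
    M.horizon * M.meanReward a θ ≤ M.optUtility θ := by
  rw [← utility_ofState hr (f := fun _ => a) measurable_const]
  exact le_ciSup (f := fun f : {f : S → A // Measurable f} =>
      M.utility (Policy.ofState f.1 f.2).toRand θ)
    ⟨M.horizon, by rintro _ ⟨f, rfl⟩; exact (utility_mem_Icc hr _ θ).2⟩ ⟨fun _ => a, measurable_const⟩

theorem exists_optUtility_eq [Nonempty A] (hr : ∀ z, M.reward z ∈ Set.Icc (0 : ℝ) 1) (θ : O) :
    ∃ a, M.optUtility θ = M.horizon * M.meanReward a θ := by
  obtain ⟨a, ha⟩ := Finite.exists_max fun a => (M.horizon : ℝ) * M.meanReward a θ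
  refine ⟨a, le_antisymm ?_ (le_optUtility hr a θ)⟩
  have : Nonempty {f : S → A // Measurable f} := ⟨⟨fun _ => a, measurable_const⟩⟩
  refine ciSup_le fun f => ?_
  rw [utility_ofState hr]
  exact ha _

theorem abs_regret_le [Nonempty A] (hr : ∀ z, M.reward z ∈ Set.Icc (0 : ℝ) 1)
    (π : RandPolicy S A Y) (θ : O) : |M.regret π θ| ≤ M.horizon := by
  obtain ⟨a, ha⟩ := exists_optUtility_eq hr θ
  have h1 := utility_mem_Icc hr π θ
  have h2 := utility_mem_Icc hr ((Policy.ofState (fun _ => a) measurable_const).toRand) θ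
  rw [utility_ofState hr, ← ha] at h2
  rw [regret, abs_le]
  constructor <;> linarith [h1.1, h1.2, h2.1, h2.2]

end MDPClass

/-! ### The exponential potentials. -/

/-- Splitting the last round off the history; a left inverse of `nextHist`. -/
def prevHist {S A Y : Type*} (t : ℕ) (z : Hist S A Y (t + 1) × S) :
    (Hist S A Y t × S) × A × Y :=
  ((fun i => z.1 i.castSucc, (z.1 (Fin.last t)).1), (z.1 (Fin.last t)).2)

theorem prevHist_nextHist {S A Y : Type*} (t : ℕ) (x : ((Hist S A Y t × S) × A) × (Y × S)) :
    prevHist t (nextHist t x) = (x.1.1, x.1.2, x.2.1) := by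
  simp [prevHist, nextHist]

theorem measurable_prevHist {S A Y : Type*} [MeasurableSpace S] [MeasurableSpace A]
    [MeasurableSpace Y] (t : ℕ) : Measurable (prevHist (S := S) (A := A) (Y := Y) t) := by
  unfold prevHist
  fun_prop

/-- The inverse of the probability `q`, cut off below `ε`. -/
noncomputable def cutInv (ε q : ℝ) : ℝ := if ε ≤ q then q⁻¹ else 0

theorem bddMeas_cutInv {X : Type*} [MeasurableSpace X] {ε : ℝ} (hε : 0 < ε) {q : X → ℝ}
    (hq : Measurable q) : BddMeas fun x => cutInv ε (q x) := by
  refine ⟨Measurable.ite (measurableSet_le measurable_const hq) hq.inv measurable_const, ε⁻¹,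
    fun x => ?_⟩
  simp only [cutInv]
  split_ifs with h
  · rw [abs_of_pos (inv_pos.2 (hε.trans_le h))]
    exact inv_anti₀ hε h
  · simpa using hε.le

namespace MDPClass

variable {S A O Y : Type*} [MeasurableSpace S] [MeasurableSpace A] [MeasurableSpace O]
  [MeasurableSpace Y] [Unique S] [Fintype A] [MeasurableSingletonClass A]
  [Finite O] [Nonempty O] [MeasurableSingletonClass O]

/-- The posterior mean of the reward of the action `a`, given the history. -/
noncomputable def predReward (M : MDPClass S A O Y) (P : Measure O) [IsProbabilityMeasure P]
    (π : RandPolicy S A Y) (t : ℕ) (a : A) (x : Hist S A Y t × S) : ℝ :=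
  ∫ θ, M.meanReward a θ ∂(posterior (M.law π t) P x)

variable {M : MDPClass S A O Y}

omit [Fintype A] [MeasurableSingletonClass A] in
theorem bddMeas_predReward (P : Measure O)
    [IsProbabilityMeasure P] (π : RandPolicy S A Y) (t : ℕ) (a : A) :
    BddMeas (M.predReward P π t a) :=
  (BddMeas.of_finite_fun.comp measurable_snd : BddMeas fun z : (Hist S A Y t × S) × O =>
    M.meanReward a z.2).integral_kernel _

omit [Fintype A] [MeasurableSingletonClass A] in
theorem predReward_mem_Icc (hr : ∀ z, M.reward z ∈ Set.Icc (0 : ℝ) 1) (P : Measure O)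
    [IsProbabilityMeasure P] (π : RandPolicy S A Y) (t : ℕ) (a : A) (x : Hist S A Y t × S) :
    M.predReward P π t a x ∈ Set.Icc (0 : ℝ) 1 := by
  refine ⟨integral_nonneg fun y => (meanReward_mem_Icc hr _ _).1, ?_⟩
  have h := integral_mono (μ := posterior (M.law π t) P x)
    (BddMeas.of_finite_fun.integrable _)
    (integrable_const 1) fun θ => (meanReward_mem_Icc hr a θ).2
  simpa [predReward] using h

/-- Under the mixture of the laws of all parameters, one round multiplies the expectation of an
exponential by at most `1`, if its increment is centered and compensated. -/
theorem integral_exp_succ_le (hr : ∀ z, M.reward z ∈ Set.Icc (0 : ℝ) 1) (P : Measure O)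
    [IsProbabilityMeasure P] (π : RandPolicy S A Y) (t : ℕ) {Φ : Hist S A Y t × S → ℝ}
    (hΦ : BddMeas Φ) {w : A → Hist S A Y t × S → ℝ}
    {Ψ : Hist S A Y (t + 1) × S → ℝ} (hΨ : BddMeas Ψ)
    (h : ∀ x a y, Ψ (nextHist t ((x, a), (y, default))) = Φ x +
      (w a x * (M.reward (y, a) - M.predReward P π t a x) - w a x ^ 2 / 8)) :
    ∫ x, Real.exp (Ψ x) ∂(M.law π (t + 1) ∘ₘ P) ≤ ∫ x, Real.exp (Φ x) ∂(M.law π t ∘ₘ P) := by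
  have hα (a : A) : BddMeas fun x => (π.kernel t x).real {a} :=
    BddMeas.kernel_real _ (measurableSet_singleton a)
  set J : A → O → Hist S A Y t × S → ℝ := fun a θ x => ∫ y,
    Real.exp (Ψ (nextHist t ((x, a), (y, default)))) ∂M.outcome (default, a, θ) with hJ
  have hi (a : A) (θ : O) : BddMeas (J a θ) :=
    (hΨ.exp.comp (u := fun z : (Hist S A Y t × S) × Y => nextHist t ((z.1, a), (z.2, default)))
      ((measurable_nextHist t).comp (by fun_prop))).integral_right _
  have hJe (a : A) (θ : O) (x : Hist S A Y t × S) : J a θ x = Real.exp (Φ x) * ∫ y,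
      Real.exp (w a x * (M.reward (y, a) - M.predReward P π t a x) - w a x ^ 2 / 8)
        ∂M.outcome (default, a, θ) := by
    rw [← integral_const_mul]
    refine integral_congr_ae (Filter.Eventually.of_forall fun y => ?_)
    simp only
    rw [h, Real.exp_add]
  set G : O → Hist S A Y t × S → ℝ := fun θ x => ∑ a, (π.kernel t x).real {a} * J a θ x with hG
  have hs (θ : O) : BddMeas (G θ) := BddMeas.sum _ fun a _ => (hα a).mul (hi a θ)
  have hGi : BddMeas fun x => ∫ θ, G θ x ∂(posterior (M.law π t) P x) :=
    BddMeas.integral_kernel_of_finite hs _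
  have e (θ : O) : ∫ x, Real.exp (Ψ x) ∂M.law π (t + 1) θ = ∫ x, G θ x ∂M.law π t θ :=
    integral_law_succ M π t θ hΨ.exp
  rw [← integral_integral_eq_comp _ _ hΨ.exp]
  simp_rw [e]
  rw [integral_integral_eq_posterior P _ hs]
  refine integral_mono (hGi.integrable _) (hΦ.exp.integrable _) fun x => ?_
  simp only [hG]
  rw [integral_finsetSum _ fun a _ => Integrable.of_finite]
  simp_rw [integral_const_mul, hJe, integral_const_mul]
  -- Given the history, the action is drawn independently of the parameter, so Hoeffding's lemma
  -- applies to each action under the posterior.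
  calc _ ≤ ∑ a, (π.kernel t x).real {a} * (Real.exp (Φ x) * 1) := by
        refine Finset.sum_le_sum fun a _ => mul_le_mul_of_nonneg_left
          (mul_le_mul_of_nonneg_left ?_ (Real.exp_pos _).le) measureReal_nonneg
        exact integral_exp_reward_le_one hr (posterior (M.law π t) P x) a (w a x)
    _ = Real.exp (Φ x) := by
        rw [← Finset.sum_mul, sum_measureReal_singleton_eq_one, one_mul, mul_one]

/-- The expected regret of the round after `t` completed rounds, with respect to `f`. -/
noncomputable def roundRegret (M : MDPClass S A O Y) (P : Measure O) (f : O → A)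
    (π : RandPolicy S A Y) (t : ℕ) : ℝ :=
  ∫ θ, M.meanReward (f θ) θ ∂P - ∫ θ, M.roundReward π t θ ∂P

/-- The factor `(π.kernel t x).real {f θ}` is the chance that the potential of `f θ` grows in this
round; it cancels the weight `l / q` in the linear term and leaves `l ^ 2 / (8 * q)` in the
quadratic one. The cutoff keeps the weights bounded and costs at most `l * ε` per action. -/
theorem le_integral_increment (hr : ∀ z, M.reward z ∈ Set.Icc (0 : ℝ) 1) (P : Measure O)
    [IsProbabilityMeasure P] (π : RandPolicy S A Y) (t : ℕ) {f : O → A}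
    (h : (M.law π t ∘ₘ P) ⊗ₘ π.kernel t = (P ⊗ₘ M.law π t).map fun z => (z.2, f z.1))
    {l ε : ℝ} (hl : 0 ≤ l) (hε : 0 < ε) :
    l * M.roundRegret P f π t - l ^ 2 * Fintype.card A / 8 - l * Fintype.card A * ε ≤
      ∫ θ, ∫ x, (π.kernel t x).real {f θ} *
        (l * cutInv ε ((π.kernel t x).real {f θ}) *
          (M.meanReward (f θ) θ - M.predReward P π t (f θ) x) -
        (l * cutInv ε ((π.kernel t x).real {f θ})) ^ 2 / 8) ∂M.law π t θ ∂P := by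
  have hα (a : A) : BddMeas fun x => (π.kernel t x).real {a} :=
    BddMeas.kernel_real _ (measurableSet_singleton a)
  have hm (a : A) := bddMeas_predReward (M := M) P π t a
  have hc (a : A) : BddMeas fun x => cutInv ε ((π.kernel t x).real {a}) :=
    bddMeas_cutInv hε (hα a).1
  -- `k` is the loss divided by `l`: cutoff plus quadratic term. The product `q * k` is `l / 8`
  -- above the cutoff and `q < ε` below it.
  set k : A → Hist S A Y t × S → ℝ := fun a x =>
    (if ε ≤ (π.kernel t x).real {a} then 0 else 1) + l / 8 * cutInv ε ((π.kernel t x).real {a})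
    with hk
  have hkb (a : A) : BddMeas (k a) :=
    (BddMeas.of_mem_Icc (a := 0) (b := 1)
      (Measurable.ite (measurableSet_le measurable_const (hα a).1) measurable_const
        measurable_const) fun x => by split_ifs <;> simp).add ((BddMeas.const _).mul (hc a))
  have e1 := integral_integral_eq_sum_kernel P (M.law π t) h hm
  have e2 := integral_integral_eq_sum_kernel P (M.law π t) h hkb
  -- Given the history, action and parameter are independent, so only the posterior mean of each arm
  -- enters.
  have e3 : ∫ x, ∑ a, (π.kernel t x).real {a} * M.predReward P π t a x ∂(M.law π t ∘ₘ P) =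
      ∫ θ, M.roundReward π t θ ∂P := by
    unfold roundReward
    rw [integral_integral_eq_posterior P (M.law π t) fun θ =>
      BddMeas.sum _ fun a _ => (hα a).mul (BddMeas.const _)]
    refine integral_congr_ae (Filter.Eventually.of_forall fun x => ?_)
    simp only
    rw [integral_finsetSum _ fun a _ => Integrable.of_finite]
    simp_rw [integral_const_mul]
    rfl
  have e4 : ∫ θ, ∫ x, k (f θ) x ∂M.law π t θ ∂P ≤ Fintype.card A * ε + l * Fintype.card A / 8 := by
    rw [e2]
    calc _ ≤ ∫ x, (Fintype.card A * ε + l * Fintype.card A / 8) ∂(M.law π t ∘ₘ P) := by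
          refine integral_mono ((BddMeas.sum _ fun a _ => (hα a).mul (hkb a)).integrable _)
            (integrable_const _) fun x => ?_
          calc _ ≤ ∑ a : A, (ε + l / 8) := by
                refine Finset.sum_le_sum fun a _ => ?_
                simp only [hk, cutInv]
                split_ifs with hq
                · have : (π.kernel t x).real {a} ≠ 0 := (hε.trans_le hq).ne'
                  field_simp
                  linarith
                · linarith
            _ = _ := by
                simp
                ring
      _ = _ := by simp
  have e5 (θ : O) : l * (M.meanReward (f θ) θ - ∫ x, M.predReward P π t (f θ) x ∂M.law π t θ) -
      l * ∫ x, k (f θ) x ∂M.law π t θ ≤ ∫ x, (π.kernel t x).real {f θ} *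
        (l * cutInv ε ((π.kernel t x).real {f θ}) *
          (M.meanReward (f θ) θ - M.predReward P π t (f θ) x) -
        (l * cutInv ε ((π.kernel t x).real {f θ})) ^ 2 / 8) ∂M.law π t θ := by
    have hd : BddMeas fun x => M.meanReward (f θ) θ - M.predReward P π t (f θ) x :=
      (BddMeas.const _).sub (hm _)
    have hlc : BddMeas fun x => l * cutInv ε ((π.kernel t x).real {f θ}) :=
      (BddMeas.const _).mul (hc _)
    have : l * (M.meanReward (f θ) θ - ∫ x, M.predReward P π t (f θ) x ∂M.law π t θ) -
      l * ∫ x, k (f θ) x ∂M.law π t θ = ∫ x, (l * (M.meanReward (f θ) θ -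
        M.predReward P π t (f θ) x) - l * k (f θ) x) ∂M.law π t θ := by
      rw [integral_sub (((BddMeas.const l).mul hd).integrable _)
        (((BddMeas.const l).mul (hkb _)).integrable _), integral_const_mul, integral_const_mul,
        integral_sub (integrable_const _) ((hm _).integrable _)]
      simp
    rw [this]
    refine integral_mono ((((BddMeas.const l).mul hd).sub
      ((BddMeas.const l).mul (hkb _))).integrable _) (((hα _).mul ((hlc.mul hd).sub (by
        simpa [sq, div_eq_mul_inv] using (hlc.mul hlc).mul (BddMeas.const (8⁻¹ : ℝ))))).integrable _)
        fun x => ?_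
    have h1 := (meanReward_mem_Icc hr (f θ) θ).2
    have h2 := (predReward_mem_Icc hr P π t (f θ) x).1
    simp only [hk, cutInv]
    split_ifs with hq
    · have : (π.kernel t x).real {f θ} ≠ 0 := (hε.trans_le hq).ne'
      apply le_of_eq
      field_simp
      ring
    -- Below the cutoff the right side is `0`, and the left side is at most `l * (1 - 0) - l`.
    · nlinarith
  have e6 := integral_mono (μ := P) Integrable.of_finite Integrable.of_finite e5
  rw [integral_sub Integrable.of_finite Integrable.of_finite, integral_const_mul,
    integral_const_mul, integral_sub Integrable.of_finite Integrable.of_finite, e1, e3] at e6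
  refine le_trans ?_ e6
  rw [roundRegret]
  nlinarith

/-- The potentials add up the increments of the successive rounds; only their boundedness,
exponential moments and expectation at `f θ` matter later. -/
theorem exists_potential (hr : ∀ z, M.reward z ∈ Set.Icc (0 : ℝ) 1) (P : Measure O)
    [IsProbabilityMeasure P] (π : RandPolicy S A Y) (T : ℕ) {f : O → A}
    (h : ∀ t < T, (M.law π t ∘ₘ P) ⊗ₘ π.kernel t =
      (P ⊗ₘ M.law π t).map fun z => (z.2, f z.1))
    {l ε : ℝ} (hl : 0 ≤ l) (hε : 0 < ε) :
    ∃ Φ : A → Hist S A Y T × S → ℝ, (∀ a, BddMeas (Φ a)) ∧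
      (∀ a, ∫ x, Real.exp (Φ a x) ∂(M.law π T ∘ₘ P) ≤ 1) ∧
      ∑ t ∈ Finset.range T,
        (l * M.roundRegret P f π t - l ^ 2 * Fintype.card A / 8 - l * Fintype.card A * ε) ≤
      ∫ θ, ∫ x, Φ (f θ) x ∂M.law π T θ ∂P := by
  classical
  induction T with
  | zero => exact ⟨fun _ _ => 0, fun _ => BddMeas.const 0, by simp, by simp⟩
  | succ t ih =>
    obtain ⟨Φ, hΦ, h1, h2⟩ := ih fun i hi => h i (hi.trans t.lt_succ_self)
    have hα (a : A) : BddMeas fun x => (π.kernel t x).real {a} :=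
      BddMeas.kernel_real _ (measurableSet_singleton a)
    -- The first index names the potential, the second the action played.
    set w : A → A → Hist S A Y t × S → ℝ := fun b a x =>
      if a = b then l * cutInv ε ((π.kernel t x).real {a}) else 0 with hwd
    have hw (b a : A) : BddMeas (w b a) := by
      by_cases hab : a = b
      · simpa [hwd, hab] using (BddMeas.const l).mul (bddMeas_cutInv hε (hα b).1)
      · simpa [hwd, hab] using BddMeas.const 0
    set φ : A → (Hist S A Y t × S) × A × Y → ℝ := fun b z =>
      w b z.2.1 z.1 * (M.reward (z.2.2, z.2.1) - M.predReward P π t z.2.1 z.1) -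
        w b z.2.1 z.1 ^ 2 / 8 with hφd
    have hφ' (b a : A) : BddMeas fun z : (Hist S A Y t × S) × Y => φ b (z.1, a, z.2) := by
      have hwz : BddMeas fun z : (Hist S A Y t × S) × Y => w b a z.1 :=
        (hw b a).comp measurable_fst
      refine (hwz.mul (((bddMeas_reward hr).comp (by fun_prop)).sub
        ((bddMeas_predReward (M := M) P π t a).comp measurable_fst))).sub ?_
      simpa [sq, div_eq_mul_inv] using (hwz.mul hwz).mul (BddMeas.const (8⁻¹ : ℝ))
    have hφ (b : A) : BddMeas (φ b) :=
      (BddMeas.of_finite (g := fun z : A × (Hist S A Y t × S) × Y => φ b (z.2.1, z.1, z.2.2))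
        (hφ' b)).comp (u := fun z : (Hist S A Y t × S) × A × Y => (z.2.1, z.1, z.2.2))
        (by fun_prop)
    have hΨ (b : A) : BddMeas fun z : Hist S A Y (t + 1) × S =>
        Φ b (prevHist t z).1 + φ b (prevHist t z) :=
      ((hΦ b).comp (measurable_fst.comp (measurable_prevHist t))).add
        ((hφ b).comp (measurable_prevHist t))
    refine ⟨_, hΨ, fun b => ?_, ?_⟩
    · exact (integral_exp_succ_le hr P π t (hΦ b) (w := w b) (hΨ b) fun x a y => by
        rw [prevHist_nextHist]).trans (h1 b)
    · rw [Finset.sum_range_succ]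
      refine (add_le_add h2 (le_integral_increment hr P π t (h t t.lt_succ_self) hl hε)).trans ?_
      rw [← integral_add Integrable.of_finite Integrable.of_finite]
      refine le_of_eq (integral_congr_ae (Filter.Eventually.of_forall fun θ => ?_))
      simp only
      have hwx (x : Hist S A Y t × S) (a : A) : ∫ y, φ (f θ) (x, a, y) ∂M.outcome (default, a, θ) =
          w (f θ) a x * (M.meanReward a θ - M.predReward P π t a x) - w (f θ) a x ^ 2 / 8 := by
        have hra : BddMeas fun y => M.reward (y, a) := (bddMeas_reward hr).comp (by fun_prop)
        simp only [hφd]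
        rw [integral_sub (((BddMeas.const _).mul (hra.sub (BddMeas.const _))).integrable _)
          (integrable_const _), integral_const_mul, integral_sub (hra.integrable _)
          (integrable_const _)]
        simp [meanReward]
      rw [integral_law_succ M π t θ (hΨ (f θ)), ← integral_add ((hΦ _).integrable _)]
      · refine integral_congr_ae (Filter.Eventually.of_forall fun x => ?_)
        simp only [prevHist_nextHist]
        have (a : A) : ∫ y, (Φ (f θ) x + φ (f θ) (x, a, y)) ∂M.outcome (default, a, θ) = _ :=
          integral_const_add_of_isProbabilityMeasure _
            ((hφ (f θ)).comp (u := fun y => (x, a, y)) (by fun_prop)) _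
        simp_rw [this, hwx, mul_add]
        rw [Finset.sum_add_distrib, ← Finset.sum_mul, sum_measureReal_singleton_eq_one, one_mul,
          Finset.sum_eq_single (f θ)]
        · simp [hwd]
        · intro a _ ha
          simp [hwd, ha]
        · simp
      · refine BddMeas.integrable ((hα _).mul ?_) _
        have := (BddMeas.const l).mul (bddMeas_cutInv hε (hα (f θ)).1)
        refine (this.mul ((BddMeas.const _).sub (bddMeas_predReward (M := M) P π t _))).sub ?_
        simpa [sq, div_eq_mul_inv] using (this.mul this).mul (BddMeas.const (8⁻¹ : ℝ))

end MDPClass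

/-! ### Entropy, and the optimization over `l`. -/

theorem integral_comp_finite_eq_sum {O A : Type*} [MeasurableSpace O] [MeasurableSpace A]
    [Finite O] [MeasurableSingletonClass O] [Fintype A] [MeasurableSingletonClass A]
    (P : Measure O) [IsProbabilityMeasure P] (f : O → A) (g : A → ℝ) :
    ∫ θ, g (f θ) ∂P = ∑ a, (P.map f).real {a} * g a := by
  have hf : Measurable f := measurable_of_countable f
  have := Measure.isProbabilityMeasure_map (μ := P) hf.aemeasurable
  rw [← integral_map hf.aemeasurable (BddMeas.of_finite_fun (g := g)).1.aestronglyMeasurable,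
    integral_fintype Integrable.of_finite]
  rfl

/-- Apply `log x ≤ x - 1` at `x = 1 / (p * |A|)`, multiply by `p` and sum; atoms with `p = 0` are
treated apart. -/
theorem shannonEntropy_le_log_card {A : Type*} [Fintype A] [Nonempty A] [MeasurableSpace A]
    [MeasurableSingletonClass A] (μ : Measure A) [IsProbabilityMeasure μ] :
    shannonEntropy μ ≤ Real.log (Fintype.card A) := by
  have hn : (0 : ℝ) < Fintype.card A := by exact_mod_cast Fintype.card_pos
  have h (a : A) : Real.negMulLog (μ.real {a}) ≤
      μ.real {a} * (Real.log (Fintype.card A) - 1) + (Fintype.card A : ℝ)⁻¹ := by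
    rcases (measureReal_nonneg (μ := μ) (s := {a})).eq_or_lt with h0 | h0
    · rw [← h0]
      simp
    · have h1 := Real.log_le_sub_one_of_pos (x := (μ.real {a} * Fintype.card A)⁻¹) (by positivity)
      rw [Real.log_inv, Real.log_mul h0.ne' hn.ne'] at h1
      have h2 := mul_le_mul_of_nonneg_left h1 h0.le
      have h3 : μ.real {a} * (μ.real {a} * Fintype.card A)⁻¹ = (Fintype.card A : ℝ)⁻¹ := by
        field_simp
      rw [Real.negMulLog]
      linarith
  refine (Finset.sum_le_sum fun a _ => h a).trans (le_of_eq ?_)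
  rw [Finset.sum_add_distrib, ← Finset.sum_mul, sum_measureReal_singleton_eq_one]
  simp [hn.ne']

/-- The best `l` divides by `T`, so `T = 0` needs its own hypothesis. -/
theorem le_sqrt_of_forall_linear_le {R n T H : ℝ} (hn : 0 < n) (hT : 0 ≤ T) (hR : T = 0 → R ≤ 0)
    (h : ∀ l ε, 0 ≤ l → 0 < ε → l * R - T * (l ^ 2 * n / 8) - T * (l * n * ε) ≤ H) :
    R ≤ √(1 / 2 * n * H * T) := by
  rcases le_or_gt R 0 with h0 | h0
  · exact h0.trans (Real.sqrt_nonneg _)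
  have hT' : 0 < T := hT.lt_of_ne fun e => absurd (hR e.symm) (not_le.2 h0)
  have h1 : 2 * R ^ 2 / (n * T) ≤ H := by
    refine le_of_forall_pos_le_add fun δ hδ => ?_
    -- The first argument maximizes `l * R - T * l ^ 2 * n / 8`; the second makes the cutoff error
    -- exactly `δ`.
    have := h (4 * R / (n * T)) (δ / (4 * R)) (by positivity) (by positivity)
    have e : 4 * R / (n * T) * R - T * ((4 * R / (n * T)) ^ 2 * n / 8) -
        T * (4 * R / (n * T) * n * (δ / (4 * R))) = 2 * R ^ 2 / (n * T) - δ := by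
      field_simp
      ring
    linarith
  refine Real.le_sqrt_of_sq_le ?_
  rw [div_le_iff₀ (by positivity)] at h1
  linarith

/-! ### Entropy duality and the regret of Thompson sampling. -/

namespace MDPClass

variable {S A O Y : Type*} [MeasurableSpace S] [MeasurableSpace A] [MeasurableSpace O]
  [MeasurableSpace Y] [Unique S] [Fintype A] [MeasurableSingletonClass A]
  [Finite O] [Nonempty O] [MeasurableSingletonClass O] {M : MDPClass S A O Y}

omit [Unique S] in
-- With `m` the law of `f θ`, the bound `1 + u ≤ exp u` at `u = log (m (f θ)) + Φ (f θ) x` is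
-- enlarged to the sum over all actions. The resulting integrand no longer depends on `θ`, so its
-- expectation is taken under the mixture, where it is at most `∑ a, m a = 1`.
theorem integral_potential_le_entropy (P : Measure O) [IsProbabilityMeasure P]
    (π : RandPolicy S A Y) (T : ℕ) (f : O → A) {Φ : A → Hist S A Y T × S → ℝ}
    (hΦ : ∀ a, BddMeas (Φ a)) (h : ∀ a, ∫ x, Real.exp (Φ a x) ∂(M.law π T ∘ₘ P) ≤ 1) :
    ∫ θ, ∫ x, Φ (f θ) x ∂M.law π T θ ∂P ≤ shannonEntropy (P.map f) := by
  have hf : Measurable f := measurable_of_countable f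
  have := Measure.isProbabilityMeasure_map (μ := P) hf.aemeasurable
  set m : A → ℝ := fun a => (P.map f).real {a} with hm
  have hm0 (a : A) : 0 ≤ m a := measureReal_nonneg
  have hb (a : A) : BddMeas fun x => m a * Real.exp (Φ a x) := (BddMeas.const _).mul (hΦ a).exp
  have h1 : ∀ᵐ θ ∂P, 1 + Real.log (m (f θ)) + ∫ x, Φ (f θ) x ∂M.law π T θ ≤
      ∑ a, m a * ∫ x, Real.exp (Φ a x) ∂M.law π T θ := by
    -- Only parameters of positive mass count; for them `m (f θ) > 0` and the logarithm is genuine.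
    rw [ae_iff_of_countable]
    intro θ hθ
    have hpos : 0 < m (f θ) := by
      refine (hm0 _).lt_of_ne' fun e => hθ ?_
      rw [hm, measureReal_eq_zero_iff, Measure.map_apply hf (measurableSet_singleton _)] at e
      exact measure_mono_null (by simp) e
    rw [← integral_const_add_of_isProbabilityMeasure _ (hΦ _)]
    simp_rw [← integral_const_mul]
    rw [← integral_finsetSum _ fun a _ => (hb a).integrable _]
    refine integral_mono (((BddMeas.const _).add (hΦ _)).integrable _)
      ((BddMeas.sum _ fun a _ => hb a).integrable _) fun x => ?_
    calc _ ≤ Real.exp (Real.log (m (f θ)) + Φ (f θ) x) := by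
          linarith [Real.add_one_le_exp (Real.log (m (f θ)) + Φ (f θ) x)]
      _ = m (f θ) * Real.exp (Φ (f θ) x) := by rw [Real.exp_add, Real.exp_log hpos]
      _ ≤ _ := Finset.single_le_sum (f := fun a => m a * Real.exp (Φ a x))
          (fun a _ => mul_nonneg (hm0 a) (Real.exp_pos _).le) (Finset.mem_univ _)
  have h2 := integral_mono_ae Integrable.of_finite Integrable.of_finite h1
  rw [integral_add Integrable.of_finite Integrable.of_finite,
    integral_add Integrable.of_finite Integrable.of_finite,
    integral_finsetSum _ fun a _ => Integrable.of_finite] at h2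
  simp_rw [integral_const_mul, fun a => integral_integral_eq_comp P (M.law π T) (hΦ a).exp] at h2
  have h3 : ∑ a, m a * ∫ x, Real.exp (Φ a x) ∂(M.law π T ∘ₘ P) ≤ 1 := by
    rw [← sum_measureReal_singleton_eq_one (P.map f)]
    exact Finset.sum_le_sum fun a _ => mul_le_of_le_one_right (hm0 a) (h a)
  have h4 : ∫ θ, Real.log (m (f θ)) ∂P = -shannonEntropy (P.map f) := by
    rw [integral_comp_finite_eq_sum P f fun a => Real.log (m a), shannonEntropy,
      ← Finset.sum_neg_distrib]
    exact Finset.sum_congr rfl fun a _ => by simp [Real.negMulLog, hm]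
  simp only [integral_const, probReal_univ, one_smul] at h2
  linarith

omit [Finite O] [MeasurableSingletonClass O] [Nonempty O] in
theorem informedUtility_eq (hr : ∀ z, M.reward z ∈ Set.Icc (0 : ℝ) 1) (P : ProbabilityMeasure O)
    {f : S × O → A} (hf : Measurable f) :
    M.informedUtility P f hf = ∫ θ, M.horizon * M.meanReward (f (default, θ)) θ ∂(P : Measure O) := by
  simp only [informedUtility, utility_ofState hr]

omit [Nonempty O] in
-- The parameterwise best action `g` is a competitor of `f`, so the benchmark of the regret is on
-- average at most the utility of playing `f`.
theorem bayesRegret_le_sum_roundRegret [Nonempty A] (hr : ∀ z, M.reward z ∈ Set.Icc (0 : ℝ) 1)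
    (P : ProbabilityMeasure O) {f : S × O → A} (hf : M.IsOptimalMap P f) (π : RandPolicy S A Y) :
    M.bayesRegret π P ≤
      ∑ t ∈ Finset.range M.horizon, M.roundRegret P (fun θ => f (default, θ)) π t := by
  obtain ⟨hf, h⟩ := hf
  choose g hg using exists_optUtility_eq (M := M) hr
  have hgm : Measurable fun x : S × O => g x.2 := (measurable_of_countable g).comp measurable_snd
  have h1 := h _ hgm
  rw [informedUtility_eq hr, informedUtility_eq hr, integral_const_mul] at h1
  simp only [roundRegret, Finset.sum_sub_distrib, Finset.sum_const, Finset.card_range, nsmul_eq_mul]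
  rw [bayesRegret]
  simp only [regret]
  rw [integral_sub Integrable.of_finite Integrable.of_finite,
    ← integral_finsetSum _ fun t _ => Integrable.of_finite]
  simp_rw [hg, utility_eq_sum hr]
  rw [integral_const_mul] at h1 ⊢
  linarith

theorem bayesRegret_le_of_isThompsonSampling [Nonempty A]
    (hr : ∀ z, M.reward z ∈ Set.Icc (0 : ℝ) 1) (P : ProbabilityMeasure O) {f : S × O → A}
    (hf : M.IsOptimalMap P f) {π : RandPolicy S A Y} (hπ : M.IsThompsonSampling P f π) :
    M.bayesRegret π P ≤ √(1 / 2 * (Fintype.card A : ℝ) *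
      shannonEntropy ((P : Measure O).map fun θ => f (default, θ)) * (M.horizon : ℝ)) := by
  refine (bayesRegret_le_sum_roundRegret hr P hf π).trans
    (le_sqrt_of_forall_linear_le (by exact_mod_cast Fintype.card_pos) (Nat.cast_nonneg _)
      (fun h => ?_) fun l ε hl hε => ?_)
  · rw [Nat.cast_eq_zero] at h
    simp [h]
  · have hTS (t : ℕ) (ht : t < M.horizon) : (M.law π t ∘ₘ (P : Measure O)) ⊗ₘ π.kernel t =
        ((P : Measure O) ⊗ₘ M.law π t).map fun z => (z.2, f (default, z.1)) := by
      rw [hπ t ht]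
      congr 1
      funext x
      rw [Subsingleton.elim x.2.2 default]
    obtain ⟨Φ, hΦ, h1, h2⟩ := exists_potential hr P π M.horizon
      (f := fun θ => f (default, θ)) hTS hl hε
    have h3 := h2.trans (integral_potential_le_entropy (M := M) (P : Measure O) π M.horizon
      (fun θ => f (default, θ)) hΦ h1)
    rw [Finset.sum_sub_distrib, Finset.sum_sub_distrib, ← Finset.mul_sum] at h3
    simpa only [Finset.sum_const, Finset.card_range, nsmul_eq_mul] using h3

omit [MeasurableSingletonClass A] [Nonempty O] in
theorem exists_isOptimalMap [Nonempty A] (P : ProbabilityMeasure O) : ∃ f, M.IsOptimalMap P f := by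
  have hm (g : S × O → A) : Measurable g := measurable_of_countable g
  obtain ⟨f, hf⟩ := Finite.exists_max fun f : S × O → A => M.informedUtility P f (hm f)
  exact ⟨f, hm f, fun g _ => hf g⟩

omit [Unique S] [Fintype A] [MeasurableSingletonClass A] [Finite O] [Nonempty O]
  [MeasurableSingletonClass O] in
theorem law_congr {π π' : RandPolicy S A Y} {t : ℕ} (h : ∀ i < t, π'.kernel i = π.kernel i) :
    M.law π' t = M.law π t := by
  induction t with
  | zero => rfl
  | succ t ih => rw [law, law, ih fun i hi => h i (hi.trans t.lt_succ_self), h t t.lt_succ_self]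

end MDPClass

/-! ### Derandomization, and existence of Thompson sampling. -/

/-- Replacing the rule of one round of a policy. -/
noncomputable def RandPolicy.update {S A Y : Type*} [MeasurableSpace S] [MeasurableSpace A]
    [MeasurableSpace Y] (π : RandPolicy S A Y) (k : ℕ) (κ : Kernel (Hist S A Y k × S) A)
    [hκ : IsMarkovKernel κ] : RandPolicy S A Y where
  kernel := Function.update π.kernel k κ
  markov t := by
    rcases eq_or_ne t k with rfl | h
    · simpa using hκ
    · simpa [h] using π.markov t

theorem exists_measurable_argmax {X A : Type*} [MeasurableSpace X] [MeasurableSpace A]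
    [Finite A] [Nonempty A] {Q : A → X → ℝ} (hQ : ∀ a, Measurable (Q a)) :
    ∃ s : X → A, Measurable s ∧ ∀ x a, Q a x ≤ Q (s x) x := by
  classical
  have := Fintype.ofFinite A
  suffices h : ∀ F : Finset A, ∃ s : X → A, Measurable s ∧ (Measurable fun x => Q (s x) x) ∧
      ∀ x, ∀ a ∈ F, Q a x ≤ Q (s x) x by
    obtain ⟨s, hs, -, h⟩ := h Finset.univ
    exact ⟨s, hs, fun x a => h x a (Finset.mem_univ a)⟩
  intro F
  induction F using Finset.induction_on with
  | empty =>
    obtain ⟨a⟩ := ‹Nonempty A›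
    exact ⟨fun _ => a, measurable_const, hQ a, by simp⟩
  | insert a F ha ih =>
    obtain ⟨s, hs, hs', h⟩ := ih
    have hset := measurableSet_lt hs' (hQ a)
    refine ⟨fun x => if Q (s x) x < Q a x then a else s x, Measurable.ite hset measurable_const hs,
      ?_, fun x b hb => ?_⟩
    · have e : (fun x => Q (if Q (s x) x < Q a x then a else s x) x) =
          fun x => if Q (s x) x < Q a x then Q a x else Q (s x) x := by
        funext x
        split_ifs <;> rfl
      rw [e]
      exact Measurable.ite hset (hQ a) hs'
    · dsimp only
      rcases Finset.mem_insert.1 hb with rfl | hb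
      · split_ifs with hx
        · exact le_rfl
        · exact not_lt.1 hx
      · split_ifs with hx
        · exact (h x b hb).trans hx.le
        · exact h x b hb

theorem sum_deterministic_mul {X A : Type*} [MeasurableSpace X] [MeasurableSpace A]
    [Fintype A] [MeasurableSingletonClass A] {s : X → A} (hs : Measurable s) (x : X) (q : A → ℝ) :
    ∑ a, (Kernel.deterministic s hs x).real {a} * q a = q (s x) := by
  rw [Finset.sum_eq_single (s x)]
  · simp [Kernel.deterministic_apply, measureReal_def]
  · intro a _ ha
    simp [Kernel.deterministic_apply, measureReal_def, ha.symm]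
  · simp

namespace MDPClass

variable {S A O Y : Type*} [MeasurableSpace S] [MeasurableSpace A] [MeasurableSpace O]
  [MeasurableSpace Y] [Unique S] [Fintype A] [MeasurableSingletonClass A]
  {M : MDPClass S A O Y}

/-- Expectations after `t + d` rounds are expectations after `t` rounds of a function that depends
only on the rules of the rounds in between. -/
theorem exists_integral_law_add (π : RandPolicy S A Y) (t d : ℕ) (θ : O)
    {g : Hist S A Y (t + d) × S → ℝ} (hg : BddMeas g) :
    ∃ G : Hist S A Y t × S → ℝ, BddMeas G ∧ ∀ π' : RandPolicy S A Y,
      (∀ i, t ≤ i → π'.kernel i = π.kernel i) →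
        ∫ x, g x ∂M.law π' (t + d) θ = ∫ x, G x ∂M.law π' t θ := by
  induction d with
  | zero => exact ⟨g, hg, fun _ _ => rfl⟩
  | succ d ih =>
    have hb : BddMeas fun x : Hist S A Y (t + d) × S => ∑ a, (π.kernel (t + d) x).real {a} *
        ∫ y, g (nextHist (t + d) ((x, a), (y, default))) ∂M.outcome (default, a, θ) :=
      BddMeas.sum _ fun a _ => (BddMeas.kernel_real _ (measurableSet_singleton a)).mul
        (BddMeas.integral_right (hg.comp
          (u := fun z : (Hist S A Y (t + d) × S) × Y => nextHist (t + d) ((z.1, a), (z.2, default)))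
          ((measurable_nextHist (t + d)).comp (by fun_prop))) _)
    obtain ⟨G, hG, h⟩ := ih hb
    refine ⟨G, hG, fun π' hπ' => ?_⟩
    rw [← h π' hπ', ← hπ' (t + d) (Nat.le_add_right t d)]
    exact integral_law_succ M π' (t + d) θ hg

variable [Nonempty A] [Finite O] [Nonempty O] [MeasurableSingletonClass O]

/-- With the other rules fixed, the prior-averaged utility is linear in the rule of round `k`: the
history law integrates `∑ a, q a * R a x`, with `R a x` the posterior expectation of the total
reward when `a` is played. A measurable maximizer of `R` therefore does at least as well. -/
theorem exists_deterministic_update (hr : ∀ z, M.reward z ∈ Set.Icc (0 : ℝ) 1) (P : Measure O)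
    [IsProbabilityMeasure P] (π : RandPolicy S A Y) {k : ℕ} (hk : k < M.horizon) :
    ∃ (s : Hist S A Y k × S → A) (hs : Measurable s),
      ∫ θ, M.utility π θ ∂P ≤
        ∫ θ, M.utility (π.update k (Kernel.deterministic s hs)) θ ∂P := by
  obtain ⟨d, hd⟩ := Nat.exists_eq_add_of_le (Nat.succ_le_of_lt hk)
  have hg (t : ℕ) : BddMeas fun x : Hist S A Y t × S =>
      ∑ i : Fin t, M.reward ((x.1 i).2.2, (x.1 i).2.1) :=
    BddMeas.sum _ fun i _ => (bddMeas_reward hr).comp (by fun_prop)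
  -- Starting at `k + 1` makes `G` independent of the rule of round `k`.
  choose G hG h using fun θ => exists_integral_law_add (M := M) π (k + 1) d θ (hg (k + 1 + d))
  set Q : O → A → Hist S A Y k × S → ℝ := fun θ a x =>
    ∫ y, G θ (nextHist k ((x, a), (y, default))) ∂M.outcome (default, a, θ) with hQ
  have hQb (θ : O) (a : A) : BddMeas (Q θ a) :=
    BddMeas.integral_right ((hG θ).comp
      (u := fun z : (Hist S A Y k × S) × Y => nextHist k ((z.1, a), (z.2, default)))
      ((measurable_nextHist k).comp (by fun_prop))) _
  have hU (π' : RandPolicy S A Y) (hπ' : ∀ i, i ≠ k → π'.kernel i = π.kernel i) (θ : O) :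
      M.utility π' θ = ∫ x, ∑ a, (π'.kernel k x).real {a} * Q θ a x ∂M.law π k θ := by
    have e1 := h θ π' fun i hi => hπ' i (Nat.ne_of_gt hi)
    rw [integral_law_succ M π' k θ (hG θ), law_congr fun i hi => hπ' i hi.ne] at e1
    rw [utility, hd]
    exact e1
  set R : A → Hist S A Y k × S → ℝ := fun a x => ∫ θ, Q θ a x ∂(posterior (M.law π k) P x)
  have hR (a : A) : BddMeas (R a) := BddMeas.integral_kernel_of_finite (fun θ => hQb θ a) _
  have hV (π' : RandPolicy S A Y) (hπ' : ∀ i, i ≠ k → π'.kernel i = π.kernel i) :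
      ∫ θ, M.utility π' θ ∂P =
        ∫ x, ∑ a, (π'.kernel k x).real {a} * R a x ∂(M.law π k ∘ₘ P) := by
    simp_rw [hU π' hπ']
    rw [integral_integral_eq_posterior P (M.law π k) fun θ => BddMeas.sum _ fun a _ =>
      (BddMeas.kernel_real _ (measurableSet_singleton a)).mul (hQb θ a)]
    refine integral_congr_ae (Filter.Eventually.of_forall fun x => ?_)
    simp only
    rw [integral_finsetSum _ fun a _ => Integrable.of_finite]
    simp_rw [integral_const_mul]
    rfl
  obtain ⟨s, hs, hmax⟩ := exists_measurable_argmax fun a => (hR a).1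
  refine ⟨s, hs, ?_⟩
  have hb (π' : RandPolicy S A Y) : BddMeas fun x => ∑ a, (π'.kernel k x).real {a} * R a x :=
    BddMeas.sum _ fun a _ => (BddMeas.kernel_real _ (measurableSet_singleton a)).mul (hR a)
  rw [hV π fun _ _ => rfl, hV (π.update k (Kernel.deterministic s hs)) fun i hi => by
    simp [RandPolicy.update, hi]]
  refine integral_mono ((hb _).integrable _) ((hb _).integrable _) fun x => ?_
  have e : (π.update k (Kernel.deterministic s hs)).kernel k = Kernel.deterministic s hs := by
    simp [RandPolicy.update]
  simp only
  rw [e, sum_deterministic_mul]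
  calc _ ≤ ∑ a, (π.kernel k x).real {a} * R (s x) x :=
        Finset.sum_le_sum fun a _ => mul_le_mul_of_nonneg_left (hmax x a) measureReal_nonneg
    _ = R (s x) x := by rw [← Finset.sum_mul, sum_measureReal_singleton_eq_one, one_mul]

/-- The rules are made deterministic one at a time, from the last round back to the first. -/
theorem exists_policy_integral_utility_le (hr : ∀ z, M.reward z ∈ Set.Icc (0 : ℝ) 1)
    (P : Measure O) [IsProbabilityMeasure P] (π : RandPolicy S A Y) :
    ∃ ρ : Policy S A Y, ∫ θ, M.utility π θ ∂P ≤ ∫ θ, M.utility ρ.toRand θ ∂P := by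
  have key (j : ℕ) (hj : j ≤ M.horizon) : ∃ π' : RandPolicy S A Y,
      (∀ i < M.horizon, M.horizon - j ≤ i →
        ∃ s hs, π'.kernel i = Kernel.deterministic s hs) ∧
      ∫ θ, M.utility π θ ∂P ≤ ∫ θ, M.utility π' θ ∂P := by
    induction j with
    | zero => exact ⟨π, fun i h1 h2 => by omega, le_rfl⟩
    | succ j ih =>
      obtain ⟨π', h1, h2⟩ := ih (by omega)
      obtain ⟨s, hs, h3⟩ := exists_deterministic_update hr P π'
        (k := M.horizon - (j + 1)) (by omega)
      refine ⟨_, fun i hi hi' => ?_, h2.trans h3⟩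
      rcases eq_or_ne i (M.horizon - (j + 1)) with rfl | hne
      · exact ⟨s, hs, by simp [RandPolicy.update]⟩
      · obtain ⟨s', hs', e⟩ := h1 i hi (by omega)
        exact ⟨s', hs', by simp [RandPolicy.update, hne, e]⟩
  obtain ⟨π', h1, h2⟩ := key M.horizon le_rfl
  obtain ⟨a⟩ := ‹Nonempty A›
  -- Beyond the horizon a constant rule serves, since the utility ignores those rounds.
  have h3 (i : ℕ) : ∃ (s : Hist S A Y i × S → A) (hs : Measurable s),
      i < M.horizon → π'.kernel i = Kernel.deterministic s hs := by
    by_cases hi : i < M.horizon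
    · obtain ⟨s, hs, e⟩ := h1 i hi (by omega)
      exact ⟨s, hs, fun _ => e⟩
    · exact ⟨fun _ => a, measurable_const, fun h => absurd h hi⟩
  choose s hs e using h3
  refine ⟨⟨s, hs⟩, h2.trans (le_of_eq ?_)⟩
  simp only [utility]
  rw [law_congr (π := Policy.toRand ⟨s, hs⟩) (π' := π') fun i hi => e i hi]

omit [Nonempty O] in
-- The rule of round `n` is the conditional kernel of the joint law of history and optimal action.
-- Installing it leaves the laws up to `n`, and hence the earlier identities, intact.
theorem exists_isThompsonSampling (P : ProbabilityMeasure O) {f : S × O → A} :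
    ∃ π, M.IsThompsonSampling P f π := by
  unfold IsThompsonSampling
  induction M.horizon with
  | zero =>
    obtain ⟨a⟩ := ‹Nonempty A›
    exact ⟨(Policy.ofState (fun _ => a) measurable_const).toRand, by simp⟩
  | succ n ih =>
    obtain ⟨π, h⟩ := ih
    have hf : Measurable f := measurable_of_countable f
    set ρ := ((P : Measure O) ⊗ₘ M.law π n).map (fun x => (x.2, f (x.2.2, x.1))) with hρ
    have hm : Measurable fun x : O × Hist S A Y n × S => f (x.2.2, x.1) := by fun_prop
    have hfst : ρ.fst = M.law π n ∘ₘ (P : Measure O) := by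
      rw [hρ, Measure.fst_map_prodMk hm, ← Measure.snd, Measure.snd_compProd]
    have hlaw (t : ℕ) (ht : t ≤ n) : M.law (π.update n ρ.condKernel) t = M.law π t :=
      law_congr fun i hi => by simp [RandPolicy.update, (hi.trans_le ht).ne]
    refine ⟨π.update n ρ.condKernel, fun t ht => ?_⟩
    rw [hlaw t (Nat.lt_succ_iff.1 ht)]
    rcases (Nat.lt_succ_iff.1 ht).eq_or_lt with rfl | ht'
    · have e : (π.update t ρ.condKernel).kernel t = ρ.condKernel := by simp [RandPolicy.update]
      rw [e, ← hfst, Measure.disintegrate]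
    · have e : (π.update n ρ.condKernel).kernel t = π.kernel t := by
        simp [RandPolicy.update, ht'.ne]
      rw [e, h t ht']

end MDPClass

/-! ### The minimax theorem for a finite parameter set. -/

/-- Evaluating a mixture of two probability measures. -/
theorem exists_probabilityMeasure_integral_convexComb {ι : Type*} [MeasurableSpace ι]
    (Q₁ Q₂ : ProbabilityMeasure ι) {a b : ℝ} (ha : 0 ≤ a) (hb : 0 ≤ b) (hab : a + b = 1) :
    ∃ Q : ProbabilityMeasure ι, ∀ g : ι → ℝ, BddMeas g →
      ∫ i, g i ∂(Q : Measure ι) =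
        a * ∫ i, g i ∂(Q₁ : Measure ι) + b * ∫ i, g i ∂(Q₂ : Measure ι) := by
  refine ⟨⟨ENNReal.ofReal a • (Q₁ : Measure ι) + ENNReal.ofReal b • (Q₂ : Measure ι), ⟨?_⟩⟩,
    fun g hg => ?_⟩
  · simp [← ENNReal.ofReal_add ha hb, hab]
  · simp only [ProbabilityMeasure.coe_mk]
    rw [integral_add_measure ((hg.integrable _).smul_measure ENNReal.ofReal_ne_top)
      ((hg.integrable _).smul_measure ENNReal.ofReal_ne_top), integral_smul_measure,
      integral_smul_measure, ENNReal.toReal_ofReal ha, ENNReal.toReal_ofReal hb]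
    rfl

theorem exists_probabilityMeasure_integral_eq_sum {O : Type*} [MeasurableSpace O] [Fintype O]
    [MeasurableSingletonClass O] {w : O → ℝ} (hw : ∀ θ, 0 ≤ w θ) (h1 : ∑ θ, w θ = 1) :
    ∃ P : ProbabilityMeasure O, ∀ g : O → ℝ, ∫ θ, g θ ∂(P : Measure O) = ∑ θ, w θ * g θ := by
  refine ⟨⟨∑ θ, ENNReal.ofReal (w θ) • Measure.dirac θ, ⟨?_⟩⟩, fun g => ?_⟩
  · simp [← ENNReal.ofReal_sum_of_nonneg fun θ _ => hw θ, h1]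
  · simp only [ProbabilityMeasure.coe_mk]
    rw [integral_finsetSum_measure fun θ _ =>
      (BddMeas.of_finite_fun.integrable _).smul_measure ENNReal.ofReal_ne_top]
    exact Finset.sum_congr rfl fun θ _ => by
      rw [integral_smul_measure, integral_dirac, ENNReal.toReal_ofReal (hw θ), smul_eq_mul]

/-- The convex set of risk vectors of mixtures misses the open orthant below the minimax value `v`.
The separating functional has nonnegative coefficients, and normalizing them gives a prior under
which every `i` has risk at least `v`. -/
theorem iInf_iSup_integral_eq_iSup_iInf_integral {ι O : Type*} [MeasurableSpace ι]
    [DiscreteMeasurableSpace ι] [Nonempty ι] [MeasurableSpace O] [Finite O] [Nonempty O]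
    [MeasurableSingletonClass O] {R : ι → O → ℝ} {B : ℝ} (hB : ∀ i θ, |R i θ| ≤ B) :
    ⨅ Q : ProbabilityMeasure ι, ⨆ θ, ∫ i, R i θ ∂(Q : Measure ι) =
      ⨆ P : ProbabilityMeasure O, ⨅ i, ∫ θ, R i θ ∂(P : Measure O) := by
  classical
  have := Fintype.ofFinite O
  have hRb (θ : O) : BddMeas fun i => R i θ := ⟨.of_discrete, B, fun i => hB i θ⟩
  have hQ (Q : ProbabilityMeasure ι) (θ : O) : |∫ i, R i θ ∂(Q : Measure ι)| ≤ B :=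
    BddMeas.abs_integral_le (fun i => hB i θ) _
  have hP (P : ProbabilityMeasure O) (i : ι) : |∫ θ, R i θ ∂(P : Measure O)| ≤ B :=
    BddMeas.abs_integral_le (fun θ => hB i θ) _
  have bQ (Q : ProbabilityMeasure ι) : BddAbove (Set.range fun θ => ∫ i, R i θ ∂(Q : Measure ι)) :=
    (Set.finite_range _).bddAbove
  have bP (P : ProbabilityMeasure O) : BddBelow (Set.range fun i => ∫ θ, R i θ ∂(P : Measure O)) :=
    ⟨-B, by rintro _ ⟨i, rfl⟩; exact (abs_le.1 (hP P i)).1⟩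
  obtain ⟨θ₀⟩ := ‹Nonempty O›
  obtain ⟨i₀⟩ := ‹Nonempty ι›
  have : Nonempty (ProbabilityMeasure ι) := ⟨⟨Measure.dirac i₀, inferInstance⟩⟩
  have : Nonempty (ProbabilityMeasure O) := ⟨⟨Measure.dirac θ₀, inferInstance⟩⟩
  have bInf : BddBelow (Set.range fun Q : ProbabilityMeasure ι =>
      ⨆ θ, ∫ i, R i θ ∂(Q : Measure ι)) :=
    ⟨-B, by rintro _ ⟨Q, rfl⟩; exact (abs_le.1 (hQ Q θ₀)).1.trans (le_ciSup (bQ Q) θ₀)⟩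
  have bSup : BddAbove (Set.range fun P : ProbabilityMeasure O =>
      ⨅ i, ∫ θ, R i θ ∂(P : Measure O)) :=
    ⟨B, by rintro _ ⟨P, rfl⟩; exact (ciInf_le (bP P) i₀).trans (abs_le.1 (hP P i₀)).2⟩
  refine le_antisymm ?_ (ciSup_le fun P => le_ciInf fun Q => ?_)
  · set v := ⨅ Q : ProbabilityMeasure ι, ⨆ θ, ∫ i, R i θ ∂(Q : Measure ι) with hv
    set U : Set (O → ℝ) := Set.univ.pi fun _ => Set.Iio v
    set C : Set (O → ℝ) :=
      Set.range fun (Q : ProbabilityMeasure ι) θ => ∫ i, R i θ ∂(Q : Measure ι)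
    have hC : Convex ℝ C := by
      rintro _ ⟨Q₁, rfl⟩ _ ⟨Q₂, rfl⟩ a b ha hb hab
      obtain ⟨Q, h⟩ := exists_probabilityMeasure_integral_convexComb Q₁ Q₂ ha hb hab
      exact ⟨Q, by funext θ; simpa using h _ (hRb θ)⟩
    have hdisj : Disjoint U C := by
      rw [Set.disjoint_left]
      rintro _ hx ⟨Q, rfl⟩
      obtain ⟨θ, hθ⟩ := exists_eq_ciSup_of_finite (f := fun θ => ∫ i, R i θ ∂(Q : Measure ι))
      have h1 := hx θ (Set.mem_univ θ)
      have h2 := ciInf_le bInf Q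
      exact absurd (h2.trans_eq hθ.symm) (not_le.2 h1)
    obtain ⟨f, u, hfU, hfC⟩ := geometric_hahn_banach_open
      (convex_pi fun _ _ => convex_Iio v) (isOpen_set_pi Set.finite_univ fun _ _ => isOpen_Iio)
      hC hdisj
    set w : O → ℝ := fun θ => f (Pi.single θ 1) with hwd
    have hf (x : O → ℝ) : f x = ∑ θ, w θ * x θ := by
      rw [← ContinuousLinearMap.coe_coe, LinearMap.pi_apply_eq_sum_univ]
      refine Finset.sum_congr rfl fun θ _ => ?_
      rw [smul_eq_mul, mul_comm, show (fun j => if θ = j then (1 : ℝ) else 0) = Pi.single θ 1 by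
        ext j; simp [Pi.single_apply, eq_comm]]
      rfl
    have hconst (δ : ℝ) : f (fun _ => v - δ) = (∑ θ, w θ) * (v - δ) := by
      rw [hf, Finset.sum_mul]
    have hle (δ : ℝ) (hδ : 0 < δ) : (∑ θ, w θ) * (v - δ) < u := by
      rw [← hconst]
      exact hfU _ fun θ _ => by simpa using hδ
    have hR (i : ι) : u ≤ ∑ θ, w θ * R i θ := by
      rw [← hf]
      exact hfC _ ⟨⟨Measure.dirac i, inferInstance⟩, by
        funext θ; simp [integral_dirac' _ _ (hRb θ).1.stronglyMeasurable]⟩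
    -- Lowering one coordinate stays in the orthant; a negative coefficient would make the
    -- functional unbounded above there.
    have hw (θ : O) : 0 ≤ w θ := by
      by_contra! hneg
      have hk (k : ℝ) (hk : 0 ≤ k) : (∑ θ, w θ) * (v - 1) - k * w θ < u := by
        have h := hfU ((fun _ => v - 1) - k • Pi.single θ 1) fun θ' _ => by
          have : 0 ≤ k * (Pi.single θ (1 : ℝ) : O → ℝ) θ' :=
            mul_nonneg hk (by rw [Pi.single_apply]; split_ifs <;> simp)
          simp only [Pi.sub_apply, Pi.smul_apply, smul_eq_mul, Set.mem_Iio]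
          linarith
        rwa [map_sub, map_smul, hconst, smul_eq_mul] at h
      -- This multiple makes `-k * w θ` equal to `|u| + |(∑ θ, w θ) * (v - 1)|`, which pushes the
      -- value up to at least `u`.
      have h0 := hk ((|u| + |(∑ θ, w θ) * (v - 1)|) / (-w θ))
        (div_nonneg (by positivity) (by linarith))
      have e : (|u| + |(∑ θ, w θ) * (v - 1)|) / (-w θ) * w θ =
          -(|u| + |(∑ θ, w θ) * (v - 1)|) := by
        have := hneg.ne
        field_simp
      rw [e] at h0
      linarith [le_abs_self u, neg_abs_le ((∑ θ, w θ) * (v - 1))]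
    -- If all coefficients vanished, separation would give `0 < u ≤ 0`.
    have hW : 0 < ∑ θ, w θ := by
      refine (Finset.sum_nonneg fun θ _ => hw θ).lt_of_ne' fun h0 => ?_
      have hz (θ : O) : w θ = 0 :=
        (Finset.sum_eq_zero_iff_of_nonneg fun θ _ => hw θ).1 h0 θ (Finset.mem_univ θ)
      have h1 := hle 1 one_pos
      have h2 := hR i₀
      simp only [hz, zero_mul, Finset.sum_const_zero] at h1 h2
      linarith
    obtain ⟨P, hPw⟩ := exists_probabilityMeasure_integral_eq_sum
      (w := fun θ => w θ / ∑ θ, w θ) (fun θ => div_nonneg (hw θ) hW.le)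
      (by rw [← Finset.sum_div, div_self hW.ne'])
    refine le_trans (le_ciInf fun i => ?_) (le_ciSup bSup P)
    rw [hPw]
    have e : ∑ θ, w θ / (∑ θ, w θ) * R i θ = (∑ θ, w θ * R i θ) / ∑ θ, w θ := by
      rw [Finset.sum_div]
      exact Finset.sum_congr rfl fun θ _ => by ring
    rw [e, le_div_iff₀ hW]
    refine le_of_forall_pos_le_add fun η hη => ?_
    have h1 := hle (η / ∑ θ, w θ) (div_pos hη hW)
    have h2 := hR i
    rw [mul_sub, mul_div_cancel₀ _ hW.ne'] at h1
    linarith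
  -- Weak duality: insert the average over both measures and exchange the integrals.
  · calc ⨅ i, ∫ θ, R i θ ∂(P : Measure O)
        = ∫ _, (⨅ i, ∫ θ, R i θ ∂(P : Measure O)) ∂(Q : Measure ι) := by simp
      _ ≤ ∫ i, ∫ θ, R i θ ∂(P : Measure O) ∂(Q : Measure ι) :=
          integral_mono (integrable_const _)
            (BddMeas.integrable ⟨.of_discrete, B, fun i => hP P i⟩ _) fun i => ciInf_le (bP P) i
      _ = ∫ θ, ∫ i, R i θ ∂(Q : Measure ι) ∂(P : Measure O) := by
          simp_rw [integral_fintype Integrable.of_finite, smul_eq_mul]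
          rw [integral_finsetSum _ fun θ _ => ((hRb θ).integrable _).const_mul _]
          simp_rw [integral_const_mul]
      _ ≤ ∫ _, (⨆ θ, ∫ i, R i θ ∂(Q : Measure ι)) ∂(P : Measure O) :=
          integral_mono Integrable.of_finite (integrable_const _) fun θ => le_ciSup (bQ Q) θ
      _ = _ := by simp

/-! ### The bounds for minimum Bayesian and minimax regret. -/

namespace MDPClass

variable {S A O Y : Type*} [MeasurableSpace S] [MeasurableSpace A] [MeasurableSpace O]
  [MeasurableSpace Y] [Unique S] [Fintype A] [MeasurableSingletonClass A]
  [Nonempty A] [Finite O] [Nonempty O] [MeasurableSingletonClass O] {M : MDPClass S A O Y}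

instance : DiscreteMeasurableSpace (Policy S A Y) := ⟨fun _ => trivial⟩

theorem minBayesRegret_le_bayesRegret (hr : ∀ z, M.reward z ∈ Set.Icc (0 : ℝ) 1)
    (P : ProbabilityMeasure O) (π : RandPolicy S A Y) : M.minBayesRegret P ≤ M.bayesRegret π P := by
  obtain ⟨ρ, hρ⟩ := exists_policy_integral_utility_le hr (P : Measure O) π
  have hb : BddBelow (Set.range fun π : Policy S A Y => M.bayesRegret π.toRand P) := by
    refine ⟨-M.horizon, ?_⟩
    rintro _ ⟨π, rfl⟩
    exact (abs_le.1 (BddMeas.abs_integral_le (fun θ => abs_regret_le hr π.toRand θ) _)).1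
  refine (ciInf_le hb ρ).trans ?_
  simp only [bayesRegret, regret]
  rw [integral_sub Integrable.of_finite Integrable.of_finite,
    integral_sub Integrable.of_finite Integrable.of_finite]
  linarith

theorem minBayesRegret_le_sqrt (hr : ∀ z, M.reward z ∈ Set.Icc (0 : ℝ) 1)
    (P : ProbabilityMeasure O) {f : S × O → A} (hf : M.IsOptimalMap P f) :
    M.minBayesRegret P ≤ √(1 / 2 * (Fintype.card A : ℝ) *
      shannonEntropy ((P : Measure O).map fun θ => f (default, θ)) * (M.horizon : ℝ)) := by
  obtain ⟨π, hπ⟩ := exists_isThompsonSampling (M := M) P (f := f)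
  exact (minBayesRegret_le_bayesRegret hr P π).trans
    (bayesRegret_le_of_isThompsonSampling hr P hf hπ)

theorem minimaxRegret_eq_worstMinBayesRegret (hr : ∀ z, M.reward z ∈ Set.Icc (0 : ℝ) 1) :
    M.minimaxRegret = M.worstMinBayesRegret := by
  obtain ⟨a⟩ := ‹Nonempty A›
  have : Nonempty A := ⟨a⟩
  have : Nonempty (Policy S A Y) := ⟨Policy.ofState (fun _ => a) measurable_const⟩
  exact iInf_iSup_integral_eq_iSup_iInf_integral
    (R := fun (π : Policy S A Y) θ => M.regret π.toRand θ)
    fun π θ => abs_regret_le hr π.toRand θ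

theorem worstMinBayesRegret_le_sqrt (hr : ∀ z, M.reward z ∈ Set.Icc (0 : ℝ) 1) :
    M.worstMinBayesRegret ≤
      √(1 / 2 * (Fintype.card A : ℝ) * Real.log (Fintype.card A) * (M.horizon : ℝ)) := by
  obtain ⟨θ₀⟩ := ‹Nonempty O›
  have : Nonempty O := ⟨θ₀⟩
  have : Nonempty (ProbabilityMeasure O) := ⟨⟨Measure.dirac θ₀, inferInstance⟩⟩
  refine ciSup_le fun P => ?_
  obtain ⟨f, hf⟩ := exists_isOptimalMap (M := M) P
  have := Measure.isProbabilityMeasure_map (μ := (P : Measure O))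
    (measurable_of_countable fun θ => f (default, θ)).aemeasurable
  refine (minBayesRegret_le_sqrt hr P hf).trans (Real.sqrt_le_sqrt ?_)
  gcongr
  exact shannonEntropy_le_log_card _

end MDPClass

theorem mainTheorem4 {S A O Y : Type*} [MeasurableSpace S] [MeasurableSpace A] [MeasurableSpace O]
    [MeasurableSpace Y] [Unique S]
    [Fintype A] [Nonempty A] [MeasurableSingletonClass A]
    [Finite O] [Nonempty O] [MeasurableSingletonClass O]
    (M : MDPClass S A O Y) (hr : ∀ z, M.reward z ∈ Set.Icc (0 : ℝ) 1) :
    M.minimaxRegret = M.worstMinBayesRegret ∧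
    (∀ P : ProbabilityMeasure O,
      (∃ f, M.IsOptimalMap P f) ∧
      ∀ f, M.IsOptimalMap P f →
        (∃ π, M.IsThompsonSampling P f π) ∧
        (∀ π, M.IsThompsonSampling P f π →
          M.bayesRegret π P ≤
            √(1 / 2 * (Fintype.card A : ℝ) *
              shannonEntropy ((P : Measure O).map fun θ => f (default, θ)) * (M.horizon : ℝ))) ∧
        M.minBayesRegret P ≤
          √(1 / 2 * (Fintype.card A : ℝ) *
            shannonEntropy ((P : Measure O).map fun θ => f (default, θ)) * (M.horizon : ℝ))) ∧
    M.minimaxRegret ≤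
      √(1 / 2 * (Fintype.card A : ℝ) * Real.log (Fintype.card A) * (M.horizon : ℝ)) :=

  ⟨MDPClass.minimaxRegret_eq_worstMinBayesRegret hr,
    fun P => ⟨MDPClass.exists_isOptimalMap P, fun _ hf =>
      ⟨MDPClass.exists_isThompsonSampling P,
        fun _ hπ => MDPClass.bayesRegret_le_of_isThompsonSampling hr P hf hπ,
        MDPClass.minBayesRegret_le_sqrt hr P hf⟩⟩,
    (MDPClass.minimaxRegret_eq_worstMinBayesRegret hr).trans_le
      (MDPClass.worstMinBayesRegret_le_sqrt hr)⟩
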